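/- Let $T>0$, let $C_0[0,T]$ be the space of real continuous functions $x$ on $[0,T]$ with $x(0)=0$, and let $\mathfrak m$ be Wiener measure on it. A property of paths holds s-a.e. if its exceptional set $N$ satisfies $\mathfrak m(\rho N)=0$ for all $\rho>0$; $F\approx G$ means that $F=G$ s-a.e. Fix a complete orthonormal sequence $(\alpha_j)$ of $L_2[0,T]$ consisting of functions of bounded variation. For $u\in L_2[0,T]$ let $$\langle u,x\rangle=\int_0^T u\,\tilde d x=\lim_{n\to\infty}\sum_{j<n}(u,\alpha_j)\int_0^T\alpha_j\,dx$$ (Riemann–Stieltjes integrals) be the Paley–Wiener–Zygmund integral, defined for those $x$ for which the limit exists, and let $\mathcal Z_h(x,\cdot)\in C_0[0,T]$ be the continuous version of the process $\mathcal Z_h(x,t)=\int_0^t h\,\tilde dx$. Let $\mathbb C_+=\{\operatorname{Re}\lambda>0\}$. For $F:C_0[0,T]\to\mathbb C$ such that $F(\rho\,\cdot)$ is Wiener measurable for every $\rho>0$ and $J(\lambda)=\int F(\lambda^{-1/2}\mathcal Z_h(x,\cdot))\,d\mathfrak m(x)$ exists and is finite for all real $\lambda>0$, the analytic continuation of $J$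 to $\mathbb C_+$, if it exists, is the generalized analytic Wiener integral of $F$. Let $T_{\lambda,h}(F)(y)$, $\lambda\in\mathbb C_+$, be the generalized analytic Wiener integral of $F(y+\cdot)$. For real $q\neq0$, a functional $G$ is a version of the generalized Fourier–Feynman transform $T_{q,h}^{(p)}(F)$ if $T_{\lambda,h}(F)(y)$ exists on $\mathbb C_+$ for s-a.e. $y$ and, as $\lambda\to-iq$ in $\mathbb C_+$, * for $p=1$: $T_{\lambda,h}(F)(y)\to G(y)$ for s-a.e. $y$; * for $1<p\le2$: $\int|T_{\lambda,h}(F)(\rho y)-G(\rho y)|^{p'}\,d\mathfrak m(y)\to0$ for every $\rho>0$, where $1/p+1/p'=1$. Let $\mathcal S(L_2[0,T])$ be the class of the functionals $F$ for which there is a complex Borel measure $f$ on $L_2[0,T]$ with $$F(x)=\int_{L_2[0,T]}\exp\{i\langle u,x\rangle\}\,df(u)$$ at every $x$ for which $\langle u,x\rangle$ exists for $|f|$-almost every $u$ (these are s-almost all $x$). Corollary 3.3. Let $h$ be a nonzero function in $L_\infty[0,T]$, let $F\in\mathcal S(L_2[0,T])$, let $p\in[1,2]$ and let $q\ne0$ be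 real. Then $T_{q,h}^{(p)}(F)$ exists and has a version in $\mathcal S(L_2[0,T])$; for every version $G\in\mathcal S(L_2[0,T])$ of it, $T_{-q,h}^{(p)}(G)$ exists, has a version in $\mathcal S(L_2[0,T])$, and every version of it is $\approx F$; that is, $$T_{-q,h}^{(p)}\big(T_{q,h}^{(p)}(F)\big)\approx F .$$ As such, $T_{q,h}^{(p)}$ has the inverse $T_{-q,h}^{(p)}$ on $\mathcal S(L_2[0,T])$: for $F,G\in\mathcal S(L_2[0,T])$, $G$ is a version of $T_{q,h}^{(p)}(F)$ if and only if $F$ is a version of $T_{-q,h}^{(p)}(G)$. -/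

import Mathlib

open MeasureTheory ProbabilityTheory Filter Topology

noncomputable section

namespace GFFT

/-- The space `C₀[0,T]` of real continuous functions on `[0,T]` vanishing at `0`, with the sup
norm. -/
def C0 (T : ℝ) [hT : Fact (0 < T)] : Submodule ℝ C(Set.Icc (0 : ℝ) T, ℝ) where
  carrier := {x | x ⟨0, le_refl 0, hT.out.le⟩ = 0}
  add_mem' := by
    intro x y hx hy
    simp only [Set.mem_ofPred_eq, ContinuousMap.add_apply] at *
    rw [hx, hy, add_zero]
  zero_mem' := rfl
  smul_mem' := by
    intro c x hx
    simp only [Set.mem_ofPred_eq, ContinuousMap.smul_apply] at *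
    rw [hx, smul_zero]

/-- The real Hilbert space `L₂[0,T]`. -/
abbrev L2 (T : ℝ) : Type := Lp ℝ 2 ((volume : Measure ℝ).restrict (Set.Icc 0 T))

instance instMeasurableSpaceL2 (T : ℝ) : MeasurableSpace (L2 T) := borel _

instance instBorelSpaceL2 (T : ℝ) : BorelSpace (L2 T) := ⟨rfl⟩

variable {T : ℝ} [hT : Fact (0 < T)]

instance instMeasurableSpaceC0 : MeasurableSpace (C0 T) := borel _

instance instBorelSpaceC0 : BorelSpace (C0 T) := ⟨rfl⟩

/-- The value `x(t)` of a path `x ∈ C₀[0,T]` at a real number `t` (used only for `t ∈ [0,T]`; the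
path is continued by constants elsewhere). -/
def value (x : C0 T) (t : ℝ) : ℝ := x.1 (Set.projIcc 0 T hT.out.le t)

/-- Wiener measure: the Borel probability measure on `C₀[0,T]` under which the coordinate process
is a centred Gaussian process with covariance `min s t`.  (Wiener measurability of a set or of a
function is measurability for the completion of this measure, that is null measurability, resp.
a.e. measurability.) -/
structure IsWienerMeasure (𝔪 : Measure (C0 T)) : Prop where
  isProbabilityMeasure : IsProbabilityMeasure 𝔪
  isGaussianProcess :
    IsGaussianProcess (fun (t : Set.Icc (0 : ℝ) T) (x : C0 T) => value x t) 𝔪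
  mean : ∀ t ∈ Set.Icc (0 : ℝ) T, ∫ x, value x t ∂𝔪 = 0
  covariance : ∀ s ∈ Set.Icc (0 : ℝ) T, ∀ t ∈ Set.Icc (0 : ℝ) T,
    ∫ x, value x s * value x t ∂𝔪 = min s t

/-- A property of paths holds scale-invariant almost everywhere: the set `N` of exceptional paths
satisfies `𝔪 (ρ N) = 0` for every `ρ > 0` (here with `ρ⁻¹` in place of `ρ`). -/
def SAE (𝔪 : Measure (C0 T)) (P : C0 T → Prop) : Prop :=
  ∀ ρ : ℝ, 0 < ρ → ∀ᵐ x ∂𝔪, P (ρ • x)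

/-- `F ≈ G`: equality scale-invariant almost everywhere. -/
def ScaleEq (𝔪 : Measure (C0 T)) (F G : C0 T → ℂ) : Prop :=
  SAE 𝔪 fun x => F x = G x

/-- Scale-invariant measurability: `F (ρ ·)` is Wiener measurable for every `ρ > 0`. -/
def ScaleMeasurable (𝔪 : Measure (C0 T)) (F : C0 T → ℂ) : Prop :=
  ∀ ρ : ℝ, 0 < ρ → AEMeasurable (fun x => F (ρ • x)) 𝔪

/-- The Riemann–Stieltjes integral `∫_0^T a(t) dx(t)` of a function `a` of bounded variation
against a continuous path `x`, as the limit of its Riemann–Stieltjes sums over the uniform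
partitions of `[0,T]`. -/
def stieltjes (a : ℝ → ℝ) (x : C0 T) : ℝ :=
  limUnder atTop fun n : ℕ =>
    ∑ k ∈ Finset.range n, a (k * T / n) * (value x ((k + 1) * T / n) - value x (k * T / n))

/-- `α` is a complete orthonormal sequence in `L₂[0,T]` that consists of functions of bounded
variation. -/
structure IsCompleteOrthonormalBV (T : ℝ) (α : ℕ → ℝ → ℝ) : Prop where
  boundedVariation : ∀ n, BoundedVariationOn (α n) (Set.Icc 0 T)
  orthonormal : ∀ m n, ∫ t in Set.Icc 0 T, α m t * α n t = if m = n then 1 else 0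
  complete : ∀ u : L2 T, (∀ n, ∫ t in Set.Icc 0 T, u t * α n t = 0) → u = 0

/-- The partial sum `∫_0^T ∑_{j<n} (u, α_j) α_j(t) dx(t)` in the definition of the
Paley–Wiener–Zygmund integral. -/
def pwzSum (α : ℕ → ℝ → ℝ) (u : ℝ → ℝ) (x : C0 T) (n : ℕ) : ℝ :=
  ∑ j ∈ Finset.range n, (∫ t in Set.Icc 0 T, u t * α j t) * stieltjes (α j) x

/-- The Paley–Wiener–Zygmund integral of `u ∈ L₂[0,T]` exists at the path `x` and equals `l`. -/
def HasPWZ (α : ℕ → ℝ → ℝ) (u : ℝ → ℝ) (x : C0 T) (l : ℝ) : Prop :=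
  Tendsto (pwzSum α u x) atTop (𝓝 l)

/-- The Paley–Wiener–Zygmund integral `⟨u, x⟩ = ∫_0^T u(t) d̃x(t)`, where it exists. -/
def pwz (α : ℕ → ℝ → ℝ) (u : ℝ → ℝ) (x : C0 T) : ℝ :=
  limUnder atTop (pwzSum α u x)

/-- `z` is the path `t ↦ ∫_0^t h(s) d̃x(s)`.  Since `z` is continuous, it suffices to require the
equation at rational times, which determine `z`. -/
def IsGaussianPath (α : ℕ → ℝ → ℝ) (h : ℝ → ℝ) (x z : C0 T) : Prop :=
  ∀ r : ℚ, (r : ℝ) ∈ Set.Icc (0 : ℝ) T →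
    HasPWZ α ((Set.Icc (0 : ℝ) r).indicator h) x (value z r)

open Classical in
/-- The path `𝒵_h(x,·) ∈ C₀[0,T]` of the Gaussian process `𝒵_h(x,t) = ∫_0^t h(s) d̃x(s)` (in its
continuous version).  For the Wiener-null set of `x` without such a path it is set to `0`. -/
def gaussianPath (α : ℕ → ℝ → ℝ) (h : ℝ → ℝ) (x : C0 T) : C0 T :=
  if H : ∃ z : C0 T, IsGaussianPath α h x z then H.choose else 0

/-- `J` is the generalized analytic Wiener integral of `F`: it is analytic on `ℂ₊`, and
`J(lam) = ∫ F(lam^{-1/2} 𝒵_h(x,·)) d𝔪(x)`, which exists and is finite, for all real `lam > 0`. -/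
structure IsAnalyticWiener (𝔪 : Measure (C0 T)) (α : ℕ → ℝ → ℝ) (h : ℝ → ℝ) (F : C0 T → ℂ)
    (J : ℂ → ℂ) : Prop where
  scaleMeasurable : ScaleMeasurable 𝔪 F
  integrable : ∀ lam : ℝ, 0 < lam →
    Integrable (fun x => F ((√lam)⁻¹ • gaussianPath α h x)) 𝔪
  eq_integral : ∀ lam : ℝ, 0 < lam →
    J lam = ∫ x, F ((√lam)⁻¹ • gaussianPath α h x) ∂𝔪
  analytic : AnalyticOnNhd ℂ J {z | 0 < z.re}

/-- The generalized analytic Wiener integral of `F` exists. -/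
def AnalyticWienerExists (𝔪 : Measure (C0 T)) (α : ℕ → ℝ → ℝ) (h : ℝ → ℝ) (F : C0 T → ℂ) : Prop :=
  ∃ J : ℂ → ℂ, IsAnalyticWiener 𝔪 α h F J

open Classical in
/-- The generalized analytic Wiener integral of `F` with parameter `lam ∈ ℂ₊`, where it exists; its
value is then unique by the identity theorem. -/
def analyticWiener (𝔪 : Measure (C0 T)) (α : ℕ → ℝ → ℝ) (h : ℝ → ℝ) (F : C0 T → ℂ) (lam : ℂ) : ℂ :=
  if H : AnalyticWienerExists 𝔪 α h F then H.choose lam else 0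

/-- `T_{lam,h}(F)(y)`, the generalized analytic Wiener integral of `F(y + ·)`. -/
def transform (𝔪 : Measure (C0 T)) (α : ℕ → ℝ → ℝ) (h : ℝ → ℝ) (F : C0 T → ℂ) (lam : ℂ)
    (y : C0 T) : ℂ :=
  analyticWiener 𝔪 α h (fun x => F (y + x)) lam

/-- The filter `lam → -iq`, `lam ∈ ℂ₊`. -/
def toMinusI (q : ℝ) : Filter ℂ := 𝓝[{z : ℂ | 0 < z.re}] (-(Complex.I * q))

/-- The `L_p` limit in the mean in the definition of the transform, `1 < p ≤ 2`, with the conjugate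
exponent `p' = p / (p - 1)`: for each `ρ > 0`,
`∫ |T_{lam,h}(F)(ρ y) - G(ρ y)|^{p'} d𝔪(y) → 0` as `lam → -iq` in `ℂ₊`. -/
def IsLimitInMean (𝔪 : Measure (C0 T)) (α : ℕ → ℝ → ℝ) (h : ℝ → ℝ) (p q : ℝ)
    (F G : C0 T → ℂ) : Prop :=
  ∀ ρ : ℝ, 0 < ρ →
    (∀ lam : ℂ, 0 < lam.re →
      AEMeasurable (fun y => transform 𝔪 α h F lam (ρ • y) - G (ρ • y)) 𝔪) ∧
    Tendsto
      (fun lam : ℂ =>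
        ∫⁻ y, ‖transform 𝔪 α h F lam (ρ • y) - G (ρ • y)‖ₑ ^ (p / (p - 1)) ∂𝔪)
      (toMinusI q) (𝓝 0)

/-- `G` is (a version of) the `L_p` analytic generalized Fourier–Feynman transform
`T_{q,h}^{(p)}(F)`, for `1 ≤ p ≤ 2`.  The transform is determined only s-a.e. -/
def IsGFFT (𝔪 : Measure (C0 T)) (α : ℕ → ℝ → ℝ) (h : ℝ → ℝ) (p q : ℝ)
    (F G : C0 T → ℂ) : Prop :=
  SAE 𝔪 (fun y => AnalyticWienerExists 𝔪 α h (fun x => F (y + x))) ∧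
  (p = 1 → SAE 𝔪 fun y =>
    Tendsto (fun lam => transform 𝔪 α h F lam y) (toMinusI q) (𝓝 (G y))) ∧
  (1 < p → IsLimitInMean 𝔪 α h p q F G)

/-- `F` is given by `F(x) = ∫ exp(i⟨u,x⟩) df(u)`, at every path `x` where `⟨u,x⟩` exists for
`|f|`-almost every `u` (which is s-almost every path). -/
def IsGivenBy (α : ℕ → ℝ → ℝ) (f : ComplexMeasure (L2 T)) (F : C0 T → ℂ) : Prop :=
  ∀ x : C0 T, (∀ᵐ u : L2 T ∂f.variation, ∃ l : ℝ, HasPWZ α u x l) →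
    F x = f.integral (fun u : L2 T => Complex.exp (Complex.I * (pwz α u x : ℂ)))
      (ContinuousLinearMap.mul ℝ ℂ)

/-- The class `𝒮(L₂[0,T])` of the functionals `F(x) = ∫ exp(i⟨u,x⟩) df(u)`, for complex Borel
measures `f` on `L₂[0,T]`. -/
def classS (α : ℕ → ℝ → ℝ) : Set (C0 T → ℂ) :=
  {F | ∃ f : ComplexMeasure (L2 T), IsGivenBy α f F}

end GFFT

end

/-! Write `F ∈ 𝒮(L₂[0,T])` with a representing measure of density `θ` against a finite measure `μ`.
For a fixed `u`, the variable `⟨u, 𝒵_h⟩` is a centred Gaussian of variance `∫ u² h²` (`energy`), so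
Fubini shows that averaging `F(y + λ^{-1/2} 𝒵_h)` multiplies `θ(u)` by `exp(-energy(u) / (2λ))`.
This `heatFactor` is analytic in `λ` on the right half-plane and bounded by one there. At the
boundary point `λ = -iq` it is the unimodular number `exp(-i energy(u) / (2q))`, whose inverse is
the factor for `-q`. On the level of densities the transforms for `q` and `-q` are therefore
mutually inverse multiplications.

Two points need real work. The first is that `F` is known only at paths where `⟨u,x⟩` exists for
almost every `u`, while the law of `𝒵_h` need not be related to any scaling of Wiener measure.
Almost sure convergence of the defining series must be shown under this law as well
(`HasVarianceDensity.ae_exists_hasPWZ`). The variables `∫ α_j dx` are then not independent, but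
adding and subtracting an independent process of complementary variance makes them so, and the two
convergent series are averaged. The continuous version of `𝒵_h` comes from comparison with a
time-changed Wiener path (`ae_exists_isGaussianPath`).

The second is that a version `G ∈ 𝒮` of the transform comes with some measure of its own. Versions
are unique up to `≈` (`IsGFFT.scaleEq`), and `F ≈ G` forces equal densities
(`Represents.ae_eq_of_scaleEq`): integrating `F - G` against `exp(-i⟨v,x⟩)` yields the integrals of
the difference of densities against Gaussian kernels centred at `v`, and these determine it.
Together they give `isGFFT_iff`: being a version of the transform is an almost everywhere equation
between densities, from which the corollary is read off. -/

noncomputable section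

namespace GFFT

/-! ### Complex measures as densities against finite measures. -/

section ComplexMeasures

variable {X : Type*} [MeasurableSpace X]

theorem integrable_mul_of_integrable_withDensity {μ : Measure X} {θ φ : X → ℂ}
    (hθm : Measurable θ) (hφ : Integrable φ (μ.withDensity fun x => ‖θ x‖ₑ)) :
    Integrable (fun x => φ x * θ x) μ ∧
      ∫⁻ x, ‖φ x * θ x‖ₑ ∂μ = ∫⁻ x, ‖φ x‖ₑ ∂(μ.withDensity fun x => ‖θ x‖ₑ) := by
  have hm : Measurable fun x => ‖θ x‖ₑ := hθm.enorm
  have hfin : ∀ᵐ x ∂μ, ‖θ x‖ₑ < ⊤ := Eventually.of_forall fun x => by simp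
  have h1 : Integrable (fun x => (‖θ x‖ₑ).toReal • φ x) μ :=
    (integrable_withDensity_iff_integrable_smul₀' hm.aemeasurable hfin).1 hφ
  have key : ∫⁻ x, ‖φ x * θ x‖ₑ ∂μ = ∫⁻ x, ‖φ x‖ₑ ∂(μ.withDensity fun x => ‖θ x‖ₑ) := by
    rw [lintegral_withDensity_eq_lintegral_mul₀' hm.aemeasurable hφ.1.enorm]
    refine lintegral_congr fun x => ?_
    simp [enorm_mul, mul_comm]
  refine ⟨⟨?_, ?_⟩, key⟩
  -- `φ` is controlled only where `θ ≠ 0`, so measurability passes through `‖θ‖ φ` and division by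
  -- `‖θ‖`; where `θ = 0` the convention `0⁻¹ = 0` is harmless.
  · have h2 : AEStronglyMeasurable (fun x => (‖θ x‖⁻¹ : ℝ) • ((‖θ x‖ₑ).toReal • φ x)) μ :=
      (hθm.norm.inv.aestronglyMeasurable).smul h1.1
    refine (h2.mul hθm.aestronglyMeasurable).congr (Eventually.of_forall fun x => ?_)
    by_cases h0 : θ x = 0
    · simp [h0]
    · have : (‖θ x‖ : ℂ) ≠ 0 := by simpa using h0
      simp [this]
  · rw [HasFiniteIntegral, key]
    exact hφ.2

/-- The variation of `θ μ` is `‖θ‖ μ`. Both sides are additive, agree on indicators, and are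
continuous in `L¹(‖θ‖ μ)`; the right side is even 1-Lipschitz. Induction over integrable functions
then applies. -/
theorem integral_withDensityᵥ {μ : Measure X} {θ φ : X → ℂ}
    (hθ : Integrable θ μ) (hθm : Measurable θ)
    (hφ : Integrable φ (μ.withDensity fun x => ‖θ x‖ₑ)) :
    (μ.withDensityᵥ θ).integral φ (ContinuousLinearMap.mul ℝ ℂ) = ∫ x, φ x * θ x ∂μ := by
  have hvar := Measure.variation_withDensityᵥ hθ
  rw [← hvar] at hφ
  have hI : ∀ {f : X → ℂ}, Integrable f (μ.withDensityᵥ θ).variation →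
      Integrable (fun x => f x * θ x) μ := fun hf =>
    (integrable_mul_of_integrable_withDensity hθm (hvar ▸ hf)).1
  refine Integrable.induction (μ := (μ.withDensityᵥ θ).variation)
    (fun φ => (μ.withDensityᵥ θ).integral φ (ContinuousLinearMap.mul ℝ ℂ) = ∫ x, φ x * θ x ∂μ)
    ?_ ?_ ?_ ?_ hφ
  · intro c s hs hs'
    rw [VectorMeasure.integral_eq_setToFun, setToFun_indicator_const _ hs hs'.ne]
    have : ∀ x, s.indicator (fun _ => c) x * θ x = s.indicator (fun x => c * θ x) x := by
      intro x
      by_cases hx : x ∈ s <;> simp [hx]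
    simp_rw [this]
    rw [integral_indicator hs, integral_const_mul, ← withDensityᵥ_apply hθ hs]
    rfl
  · intro f g _ hf hg h1 h2
    rw [VectorMeasure.integral_add hf hg, h1, h2, ← integral_add (hI hf) (hI hg)]
    simp [add_mul]
  · refine isClosed_eq VectorMeasure.continuous_integral ?_
    refine LipschitzWith.continuous (K := 1) ?_
    intro f g
    have hfg : Integrable (f - g : X →₁[(μ.withDensityᵥ θ).variation] ℂ)
      (μ.withDensityᵥ θ).variation := L1.integrable_coeFn _
    have h0 : ∀ᵐ x ∂μ.withDensity (fun x => ‖θ x‖ₑ), (f - g : Lp ℂ 1 _) x = f x - g x := by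
      rw [← hvar]
      exact Lp.coeFn_sub f g
    have h1 : ∀ᵐ x ∂μ, (f - g : Lp ℂ 1 _) x * θ x = f x * θ x - g x * θ x := by
      rw [ae_withDensity_iff hθm.enorm] at h0
      filter_upwards [h0] with x hx
      by_cases hz : θ x = 0
      · simp [hz]
      · rw [hx (by simpa using hz)]
        ring
    rw [edist_eq_enorm_sub, ← integral_sub (hI (L1.integrable_coeFn _))
      (hI (L1.integrable_coeFn _)), ← integral_congr_ae h1]
    refine (enorm_integral_le_lintegral_enorm _).trans ?_
    rw [(integrable_mul_of_integrable_withDensity hθm (hvar ▸ hfg)).2, ← hvar, ENNReal.coe_one,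
      one_mul, edist_eq_enorm_sub, Lp.enorm_def, eLpNorm_one_eq_lintegral_enorm]
  · intro f g hfg hf h
    rw [← VectorMeasure.integral_congr_ae hfg, h]
    refine integral_congr_ae ?_
    rw [hvar, EventuallyEq, ae_withDensity_iff hθm.enorm] at hfg
    filter_upwards [hfg] with x hx
    by_cases hz : θ x = 0
    · simp [hz]
    · simp only [hx (by simpa using hz)]

/-- Serves to make the variation of a complex measure finite. -/
theorem ComplexMeasure.variation_le (f : ComplexMeasure X) :
    f.variation ≤ (ComplexMeasure.re f).totalVariation + (ComplexMeasure.im f).totalVariation := by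
  refine VectorMeasure.variation_le_of_forall_enorm_le fun E _ => ?_
  rw [Measure.add_apply]
  refine le_trans ?_ (add_le_add (SignedMeasure.enorm_le_totalVariation _ E)
    (SignedMeasure.enorm_le_totalVariation _ E))
  have h : f E = ((ComplexMeasure.re f E : ℝ) : ℂ) + ((ComplexMeasure.im f E : ℝ) : ℂ) * Complex.I := by
    exact (Complex.re_add_im (f E)).symm
  rw [h]
  refine (enorm_add_le _ _).trans (add_le_add ?_ ?_)
  · rw [← ofReal_norm, ← ofReal_norm, Complex.norm_real]
  · rw [← ofReal_norm, ← ofReal_norm, norm_mul, Complex.norm_real, Complex.norm_I, mul_one]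

theorem ComplexMeasure.isFiniteMeasure_variation (f : ComplexMeasure X) :
    IsFiniteMeasure f.variation :=
  isFiniteMeasure_of_le _ (ComplexMeasure.variation_le f)

/-- The Radon–Nikodym theorem for a complex measure dominated by a finite measure. -/
theorem ComplexMeasure.exists_withDensityᵥ_eq (f : ComplexMeasure X) (μ : Measure X)
    [IsFiniteMeasure μ] (hf : f.variation ≪ μ) :
    ∃ θ : X → ℂ, Measurable θ ∧ Integrable θ μ ∧ μ.withDensityᵥ θ = f := by
  have hac : f ≪ᵥ μ.toENNRealVectorMeasure := by
    refine VectorMeasure.AbsolutelyContinuous.mk fun s hs h0 => ?_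
    rw [Measure.toENNRealVectorMeasure_apply_measurable hs] at h0
    have := VectorMeasure.enorm_measure_le_variation f s
    rw [hf h0] at this
    simpa using this
  obtain ⟨hre, him⟩ := (ComplexMeasure.absolutelyContinuous_ennreal_iff f _).1 hac
  have h1 := SignedMeasure.withDensityᵥ_rnDeriv_eq _ _ hre
  have h2 := SignedMeasure.withDensityᵥ_rnDeriv_eq _ _ him
  refine ⟨f.rnDeriv μ, ?_, ComplexMeasure.integrable_rnDeriv f μ, ?_⟩
  · have : f.rnDeriv μ = fun x => ((ComplexMeasure.re f).rnDeriv μ x : ℂ) +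
        ((ComplexMeasure.im f).rnDeriv μ x : ℂ) * Complex.I := by
      ext x
      exact (Complex.re_add_im (f.rnDeriv μ x)).symm
    rw [this]
    exact (Complex.measurable_ofReal.comp (SignedMeasure.measurable_rnDeriv _ _)).add
      ((Complex.measurable_ofReal.comp (SignedMeasure.measurable_rnDeriv _ _)).mul_const _)
  · ext i hi : 1
    have hint := ComplexMeasure.integrable_rnDeriv f μ
    apply Complex.ext
    · rw [withDensityᵥ_apply hint hi, ← RCLike.re_eq_complex_re, ← integral_re hint.integrableOn,
        RCLike.re_eq_complex_re]
      have := congrArg (fun s : SignedMeasure X => s i) h1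
      simp only [withDensityᵥ_apply (SignedMeasure.integrable_rnDeriv _ _) hi] at this
      exact this
    · rw [withDensityᵥ_apply hint hi, ← RCLike.im_eq_complex_im, ← integral_im hint.integrableOn,
        RCLike.im_eq_complex_im]
      have := congrArg (fun s : SignedMeasure X => s i) h2
      simp only [withDensityᵥ_apply (SignedMeasure.integrable_rnDeriv _ _) hi] at this
      exact this

end ComplexMeasures

/-! ### Uniqueness of densities from Gaussian integrals on a Hilbert space. -/

section Injectivity

variable {H : Type*} [NormedAddCommGroup H] [InnerProductSpace ℝ H] [CompleteSpace H]
  [SecondCountableTopology H] [MeasurableSpace H] [BorelSpace H]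

/-- Exponential moments finite in every direction make the complex moment generating function of
`⟨·,v⟩` entire. Equality on the real axis therefore carries over to the point `i`, where it is the
characteristic function at `v`. -/
theorem ext_of_integral_exp_inner {ν₁ ν₂ : Measure H} [IsFiniteMeasure ν₁] [IsFiniteMeasure ν₂]
    (h₁ : ∀ v : H, Integrable (fun u => Real.exp (inner ℝ u v)) ν₁)
    (h : ∀ v : H, ∫ u, Real.exp (inner ℝ u v) ∂ν₁ = ∫ u, Real.exp (inner ℝ u v) ∂ν₂) :
    ν₁ = ν₂ := by
  have hset : ∀ (ν : Measure H), (∀ v : H, Integrable (fun u => Real.exp (inner ℝ u v)) ν) →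
      ∀ v : H, integrableExpSet (fun u => inner ℝ u v) ν = Set.univ := by
    intro ν hν v
    ext t
    simp only [integrableExpSet, Set.mem_ofPred_eq, Set.mem_univ, iff_true]
    simpa [inner_smul_right] using hν (t • v)
  refine Measure.ext_of_charFun (funext fun v => ?_)
  have hmgf : mgf (fun u : H => inner ℝ u v) ν₁ = mgf (fun u : H => inner ℝ u v) ν₂ := by
    ext t
    simpa [mgf, inner_smul_right] using h (t • v)
  have hz : ν₁ = 0 ↔ ν₂ = 0 := by
    have h0 := h 0
    simp only [inner_zero_right, Real.exp_zero, integral_const, smul_eq_mul, mul_one] at h0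
    rw [← Measure.measure_univ_eq_zero, ← Measure.measure_univ_eq_zero, ← measureReal_eq_zero_iff,
      ← measureReal_eq_zero_iff, h0]
  have hE := eqOn_complexMGF_of_mgf' hmgf hz
  rw [hset ν₁ h₁ v] at hE
  have := hE (x := Complex.I) (by simp)
  simp only [complexMGF] at this
  simp only [charFun]
  simpa [mul_comm] using this

/-- Expanding the square splits the kernel into `w(u) exp⟨u,v⟩` and a factor depending on `v` only.
The hypothesis then says that the measures `w θ⁺ μ` and `w θ⁻ μ` have the same exponential moments.
The weight `w` makes these moments finite, since `w(u) exp⟨u,v⟩ ≤ exp(‖v‖²/2)`. -/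
theorem ae_eq_zero_of_integral_gaussian_real {μ : Measure H} [IsFiniteMeasure μ] {θ : H → ℝ}
    (hθm : Measurable θ) (hθ : Integrable θ μ)
    (h : ∀ v : H, ∫ u, Real.exp (-‖u - v‖ ^ 2 / 2) * θ u ∂μ = 0) : θ =ᵐ[μ] 0 := by
  set w : H → ℝ := fun u => Real.exp (-‖u‖ ^ 2 / 2) with hw
  have hwm : Measurable w := by fun_prop
  have hpos : ∀ u, 0 < w u := fun u => Real.exp_pos _
  have hsq : ∀ u v : H, Real.exp (-‖u - v‖ ^ 2 / 2) =
      w u * Real.exp (inner ℝ u v) * Real.exp (-‖v‖ ^ 2 / 2) := by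
    intro u v
    rw [hw, ← Real.exp_add, ← Real.exp_add, norm_sub_sq_real]
    congr 1
    ring
  have hle : ∀ u v : H, w u * Real.exp (inner ℝ u v) ≤ Real.exp (‖v‖ ^ 2 / 2) := by
    intro u v
    have h1 := hsq u v
    have h2 : Real.exp (-‖u - v‖ ^ 2 / 2) ≤ 1 := by
      rw [Real.exp_le_one_iff]
      nlinarith [sq_nonneg ‖u - v‖]
    have h3 : Real.exp (-‖v‖ ^ 2 / 2) * Real.exp (‖v‖ ^ 2 / 2) = 1 := by
      rw [← Real.exp_add, ← Real.exp_zero]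
      congr 1
      ring
    calc w u * Real.exp (inner ℝ u v)
        = (w u * Real.exp (inner ℝ u v)) * (Real.exp (-‖v‖ ^ 2 / 2) * Real.exp (‖v‖ ^ 2 / 2)) := by
          rw [h3, mul_one]
      _ = Real.exp (-‖u - v‖ ^ 2 / 2) * Real.exp (‖v‖ ^ 2 / 2) := by rw [h1]; ring
      _ ≤ 1 * Real.exp (‖v‖ ^ 2 / 2) := by gcongr
      _ = _ := one_mul _
  have main : ∀ τ : H → ℝ, Measurable τ → Integrable τ μ → (∀ u, 0 ≤ τ u) →
      IsFiniteMeasure (μ.withDensity fun u => ENNReal.ofReal (w u * τ u)) ∧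
      ∀ v : H, Integrable (fun u => w u * τ u * Real.exp (inner ℝ u v)) μ ∧
        Integrable (fun u => Real.exp (inner ℝ u v))
        (μ.withDensity fun u => ENNReal.ofReal (w u * τ u)) ∧
        ∫ u, Real.exp (inner ℝ u v) ∂(μ.withDensity fun u => ENNReal.ofReal (w u * τ u)) =
          ∫ u, w u * τ u * Real.exp (inner ℝ u v) ∂μ := by
    intro τ hτm hτ hτ0
    have hm : Measurable fun u => ENNReal.ofReal (w u * τ u) := (hwm.mul hτm).ennreal_ofReal
    have hI : ∀ v : H, Integrable (fun u => w u * τ u * Real.exp (inner ℝ u v)) μ := by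
      intro v
      refine (hτ.const_mul (Real.exp (‖v‖ ^ 2 / 2))).mono' (by fun_prop)
        (Eventually.of_forall fun u => ?_)
      rw [Real.norm_of_nonneg (by have := hpos u; have := hτ0 u; positivity)]
      calc w u * τ u * Real.exp (inner ℝ u v) = (w u * Real.exp (inner ℝ u v)) * τ u := by ring
        _ ≤ _ := mul_le_mul_of_nonneg_right (hle u v) (hτ0 u)
    refine ⟨?_, fun v => ⟨hI v, ?_, ?_⟩⟩
    · have := hI 0
      simp only [inner_zero_right, Real.exp_zero, mul_one] at this
      exact isFiniteMeasure_withDensity_ofReal this.2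
    · rw [integrable_withDensity_iff_integrable_smul' hm (by simp)]
      refine (hI v).congr (Eventually.of_forall fun u => ?_)
      simp only [smul_eq_mul]
      rw [ENNReal.toReal_ofReal (mul_nonneg (hpos u).le (hτ0 u))]
    · rw [integral_withDensity_eq_integral_toReal_smul hm (by simp)]
      refine integral_congr_ae (Eventually.of_forall fun u => ?_)
      simp only [smul_eq_mul]
      rw [ENNReal.toReal_ofReal (mul_nonneg (hpos u).le (hτ0 u))]
  obtain ⟨f1, g1⟩ := main (fun u => max (θ u) 0) (hθm.max measurable_const) hθ.pos_part
    (fun u => le_max_right _ _)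
  obtain ⟨f2, g2⟩ := main (fun u => max (-θ u) 0) (hθm.neg.max measurable_const) hθ.neg_part
    (fun u => le_max_right _ _)
  have heq := ext_of_integral_exp_inner
    (ν₂ := μ.withDensity fun u => ENNReal.ofReal (w u * max (-θ u) 0)) (fun v => (g1 v).2.1) fun v => by
    rw [(g1 v).2.2, (g2 v).2.2, ← sub_eq_zero, ← integral_sub (g1 v).1 (g2 v).1]
    have h0 := h v
    have : ∀ u, Real.exp (-‖u - v‖ ^ 2 / 2) * θ u = Real.exp (-‖v‖ ^ 2 / 2) *
        (w u * max (θ u) 0 * Real.exp (inner ℝ u v) -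
          w u * max (-θ u) 0 * Real.exp (inner ℝ u v)) := by
      intro u
      have : θ u = max (θ u) 0 - max (-θ u) 0 := by
        rcases le_total 0 (θ u) with h | h
        · simp [h]
        · simp [h]
      rw [hsq]
      nth_rw 1 [this]
      ring
    simp_rw [this] at h0
    rw [integral_const_mul] at h0
    exact (mul_eq_zero.1 h0).resolve_left (Real.exp_pos _).ne'
  rw [withDensity_eq_iff] at heq
  · filter_upwards [heq] with u hu
    have h1 := (ENNReal.ofReal_eq_ofReal_iff (mul_nonneg (hpos u).le (le_max_right _ _))
      (mul_nonneg (hpos u).le (le_max_right _ _))).1 hu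
    have h2 := mul_left_cancel₀ (hpos u).ne' h1
    simp only [Pi.zero_apply]
    rcases le_total 0 (θ u) with h | h
    · simpa [h] using h2
    · simpa [h] using h2
  · exact (hwm.mul (hθm.max measurable_const)).ennreal_ofReal.aemeasurable
  · exact (hwm.mul (hθm.neg.max measurable_const)).ennreal_ofReal.aemeasurable
  · have := f1.measure_univ_lt_top.ne
    rwa [withDensity_apply _ MeasurableSet.univ, Measure.restrict_univ] at this

/-- A complex density is determined by its integrals against the Gaussian kernels
`exp (-‖u - v‖² / 2)`. -/
theorem ae_eq_zero_of_integral_gaussian {μ : Measure H} [IsFiniteMeasure μ] {θ : H → ℂ}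
    (hθm : Measurable θ) (hθ : Integrable θ μ)
    (h : ∀ v : H, ∫ u, (Real.exp (-‖u - v‖ ^ 2 / 2) : ℂ) * θ u ∂μ = 0) : θ =ᵐ[μ] 0 := by
  have hI : ∀ v : H, Integrable (fun u => (Real.exp (-‖u - v‖ ^ 2 / 2) : ℂ) * θ u) μ := by
    intro v
    refine hθ.bdd_mul (c := 1) (by fun_prop) (Eventually.of_forall fun u => ?_)
    rw [Complex.norm_real, Real.norm_of_nonneg (Real.exp_pos _).le, Real.exp_le_one_iff]
    nlinarith [sq_nonneg ‖u - v‖]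
  have hre := ae_eq_zero_of_integral_gaussian_real (Complex.measurable_re.comp hθm) hθ.re
    (fun v => by
      have := congrArg Complex.re (h v)
      rw [← RCLike.re_eq_complex_re, ← integral_re (hI v)] at this
      simpa only [RCLike.re_eq_complex_re, Complex.re_ofReal_mul, Complex.zero_re, Function.comp_apply]
        using this)
  have him := ae_eq_zero_of_integral_gaussian_real (Complex.measurable_im.comp hθm) hθ.im
    (fun v => by
      have := congrArg Complex.im (h v)
      rw [← RCLike.im_eq_complex_im, ← integral_im (hI v)] at this
      simpa only [RCLike.im_eq_complex_im, Complex.im_ofReal_mul, Complex.zero_im, Function.comp_apply]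
        using this)
  filter_upwards [hre, him] with u h1 h2
  exact Complex.ext h1 h2

end Injectivity

end GFFT

/-! ### Riemann–Stieltjes integrals against continuous paths. -/

namespace GFFT

variable {T : ℝ} [hT : Fact (0 < T)]

theorem continuous_value_left (t : ℝ) : Continuous fun x : C0 T => value x t :=
  (continuous_eval_const (F := C(Set.Icc (0 : ℝ) T, ℝ)) _).comp continuous_subtype_val

theorem uniformContinuous_value (x : C0 T) : UniformContinuous (value x) :=
  (CompactSpace.uniformContinuous_of_continuous x.1.continuous).comp
    (LipschitzWith.projIcc hT.out.le).uniformContinuous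

@[simp] theorem value_add (x y : C0 T) (t : ℝ) : value (x + y) t = value x t + value y t := rfl

@[simp] theorem value_smul (c : ℝ) (x : C0 T) (t : ℝ) : value (c • x) t = c * value x t := rfl

@[simp] theorem value_zero_left (t : ℝ) : value (0 : C0 T) t = 0 := rfl

/-- The Riemann–Stieltjes sum over the uniform partition into `n` intervals. -/
def rsSum (a : ℝ → ℝ) (x : C0 T) (n : ℕ) : ℝ :=
  ∑ k ∈ Finset.range n, a (k * T / n) * (value x ((k + 1) * T / n) - value x (k * T / n))

theorem sum_range_mul (f : ℕ → ℝ) (n m : ℕ) :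
    ∑ i ∈ Finset.range (n * m), f i = ∑ k ∈ Finset.range n, ∑ j ∈ Finset.range m, f (k * m + j) := by
  induction n with
  | zero => simp
  | succ n ih => rw [Nat.succ_mul, Finset.sum_range_add, ih, Finset.sum_range_succ]

/-- Summation by parts. The free constant `c` lets the induction on `m` run; the choice `c = y m`
later removes the last boundary term. -/
theorem abel_block_identity (b y : ℕ → ℝ) (c : ℝ) (m : ℕ) :
    b 0 * (c - y 0) - ∑ j ∈ Finset.range m, b j * (y (j + 1) - y j) - b m * (c - y m) =
      -∑ j ∈ Finset.range m, (b (j + 1) - b j) * (c - y (j + 1)) := by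
  induction m with
  | zero => simp
  | succ m ih =>
    rw [Finset.sum_range_succ, Finset.sum_range_succ]
    linear_combination ih

theorem abs_abel_block_le (b y : ℕ → ℝ) (m : ℕ) {ε : ℝ} (h : ∀ j ≤ m, |y m - y j| ≤ ε) :
    |b 0 * (y m - y 0) - ∑ j ∈ Finset.range m, b j * (y (j + 1) - y j)| ≤
      ε * ∑ j ∈ Finset.range m, |b (j + 1) - b j| := by
  have := abel_block_identity b y (y m) m
  rw [sub_self, mul_zero, sub_zero] at this
  rw [this, abs_neg, Finset.mul_sum]
  refine (Finset.abs_sum_le_sum_abs _ _).trans (Finset.sum_le_sum fun j hj => ?_)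
  rw [abs_mul, mul_comm]
  exact mul_le_mul_of_nonneg_right (h _ (Finset.mem_range.1 hj)) (abs_nonneg _)

theorem sum_abs_sub_le {a : ℝ → ℝ} (ha : BoundedVariationOn a (Set.Icc 0 T)) (n : ℕ) :
    ∑ i ∈ Finset.range n, |a ((i + 1) * T / n) - a (i * T / n)| ≤
      (eVariationOn a (Set.Icc 0 T)).toReal := by
  have hT0 := hT.out
  rcases Nat.eq_zero_or_pos n with rfl | hn
  · simp
  have hn' : (0 : ℝ) < n := by exact_mod_cast hn
  have h := eVariationOn.sum_le_of_monotoneOn_Iic (f := a) (s := Set.Icc 0 T) (n := n)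
    (u := fun i : ℕ => (i : ℝ) * T / n) (fun i _ j _ hij => by
      have : (i : ℝ) ≤ j := by exact_mod_cast hij
      dsimp only
      gcongr) (fun i hi => by
      have : (i : ℝ) ≤ n := by exact_mod_cast hi
      refine ⟨by positivity, ?_⟩
      rw [div_le_iff₀ hn', mul_comm]
      gcongr)
  rw [← ENNReal.toReal_le_toReal (by simp [edist_ne_top]) ha,
    ENNReal.toReal_sum (by simp [edist_ne_top])] at h
  refine le_trans (le_of_eq ?_) h
  refine Finset.sum_congr rfl fun i _ => ?_
  rw [← dist_edist, Real.dist_eq]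
  push_cast
  rfl

/-- Each coarse cell is a block of `m` fine cells. Summation by parts bounds its error by the
oscillation of `x` on the cell times the variation of `a` there, and the variations add up. -/
theorem abs_rsSum_sub_refinement_le {a : ℝ → ℝ} (ha : BoundedVariationOn a (Set.Icc 0 T))
    (x : C0 T) {n m : ℕ} (hn : 0 < n) (hm : 0 < m) {ε : ℝ} (hε : 0 ≤ ε)
    (h : ∀ s t : ℝ, |s - t| ≤ T / n → |value x s - value x t| ≤ ε) :
    |rsSum a x n - rsSum a x (n * m)| ≤ ε * (eVariationOn a (Set.Icc 0 T)).toReal := by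
  have hT0 := hT.out
  have hn' : (0 : ℝ) < n := by exact_mod_cast hn
  have hm' : (0 : ℝ) < m := by exact_mod_cast hm
  set s : ℕ → ℝ := fun i => (i : ℝ) * T / (n * m : ℕ) with hs
  have hs0 : ∀ k : ℕ, s (k * m) = k * T / n := by
    intro k
    simp only [hs]
    push_cast
    field_simp
  have hs1 : ∀ k : ℕ, s (k * m + m) = (k + 1) * T / n := by
    intro k
    simp only [hs]
    push_cast
    field_simp
  have e1 : rsSum a x n = ∑ k ∈ Finset.range n,
      a (s (k * m + 0)) * (value x (s (k * m + m)) - value x (s (k * m + 0))) := by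
    refine Finset.sum_congr rfl fun k _ => ?_
    rw [add_zero, hs0, hs1]
  have e2 : rsSum a x (n * m) = ∑ k ∈ Finset.range n, ∑ j ∈ Finset.range m,
      a (s (k * m + j)) * (value x (s (k * m + (j + 1))) - value x (s (k * m + j))) := by
    rw [rsSum, sum_range_mul (fun i : ℕ => a (i * T / (n * m : ℕ)) *
      (value x ((i + 1) * T / (n * m : ℕ)) - value x (i * T / (n * m : ℕ))))]
    refine Finset.sum_congr rfl fun k _ => Finset.sum_congr rfl fun j _ => ?_
    simp only [hs]
    push_cast
    ring_nf
  rw [e1, e2, ← Finset.sum_sub_distrib]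
  refine (Finset.abs_sum_le_sum_abs _ _).trans ?_
  have hblock : ∀ k ∈ Finset.range n, |a (s (k * m + 0)) *
      (value x (s (k * m + m)) - value x (s (k * m + 0))) - ∑ j ∈ Finset.range m,
      a (s (k * m + j)) * (value x (s (k * m + (j + 1))) - value x (s (k * m + j)))| ≤
      ε * ∑ j ∈ Finset.range m, |a (s (k * m + (j + 1))) - a (s (k * m + j))| := by
    intro k _
    refine abs_abel_block_le (fun j => a (s (k * m + j))) (fun j => value x (s (k * m + j))) m ?_
    intro j hj
    refine h _ _ ?_
    have hj' : (j : ℝ) ≤ m := by exact_mod_cast hj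
    have : s (k * m + m) - s (k * m + j) = (m - j) * (T / (n * m)) := by
      simp only [hs]
      push_cast
      field_simp
      ring
    rw [this, abs_of_nonneg (mul_nonneg (by linarith) (by positivity))]
    calc ((m : ℝ) - j) * (T / (n * m)) ≤ m * (T / (n * m)) := by
          gcongr
          have : (0 : ℝ) ≤ j := by positivity
          linarith
      _ = T / n := by field_simp
  refine (Finset.sum_le_sum hblock).trans ?_
  rw [← Finset.mul_sum]
  refine mul_le_mul_of_nonneg_left ?_ hε
  refine le_trans (le_of_eq ?_) (sum_abs_sub_le ha (n * m))
  rw [sum_range_mul (fun i : ℕ => |a ((i + 1) * T / (n * m : ℕ)) - a (i * T / (n * m : ℕ))|)]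
  refine Finset.sum_congr rfl fun k _ => Finset.sum_congr rfl fun j _ => ?_
  simp only [hs]
  push_cast
  ring_nf

/-- The Riemann–Stieltjes integral of a function of bounded variation against a continuous path
exists. -/
theorem tendsto_rsSum {a : ℝ → ℝ} (ha : BoundedVariationOn a (Set.Icc 0 T)) (x : C0 T) :
    Tendsto (rsSum a x) atTop (𝓝 (stieltjes a x)) := by
  have hT0 := hT.out
  suffices CauchySeq (rsSum a x) from
    tendsto_nhds_limUnder (cauchySeq_tendsto_of_complete this)
  set V := (eVariationOn a (Set.Icc 0 T)).toReal
  have hV : 0 ≤ V := ENNReal.toReal_nonneg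
  rw [Metric.cauchySeq_iff]
  intro ε hε
  -- The added 1 guards against zero variation. The 3 leaves room for two comparisons: the sums for
  -- `n` and `m` are both compared with that for `n * m`.
  obtain ⟨δ, hδ, hx⟩ := Metric.uniformContinuous_iff.1 (uniformContinuous_value x)
    (ε / (3 * (V + 1))) (by positivity)
  obtain ⟨N, hN⟩ := exists_nat_gt (T / δ)
  have key : ∀ n m : ℕ, N + 1 ≤ n → 0 < m → |rsSum a x n - rsSum a x (n * m)| ≤ ε / 3 := by
    intro n m hn hm
    have hn' : (0 : ℝ) < n := by
      have : 0 < n := by omega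
      exact_mod_cast this
    have hNn : (N : ℝ) < n := by
      have : N < n := by omega
      exact_mod_cast this
    refine (abs_rsSum_sub_refinement_le ha x (by omega) hm (ε := ε / (3 * (V + 1)))
      (by positivity) ?_).trans ?_
    · intro s t hst
      refine (hx (a := s) (b := t) ?_).le
      rw [Real.dist_eq]
      refine hst.trans_lt ?_
      rw [div_lt_iff₀ hn', mul_comm, ← div_lt_iff₀ hδ]
      exact hN.trans hNn
    · calc ε / (3 * (V + 1)) * V ≤ ε / (3 * (V + 1)) * (V + 1) := by gcongr; linarith
        _ = ε / 3 := by field_simp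
  refine ⟨N + 1, fun m hm n hn => ?_⟩
  have h1 := key m n hm (by omega)
  have h2 := key n m hn (by omega)
  rw [mul_comm] at h2
  rw [Real.dist_eq]
  rw [abs_le] at h1 h2
  rw [abs_lt]
  constructor <;> linarith

theorem stieltjes_add {a : ℝ → ℝ} (ha : BoundedVariationOn a (Set.Icc 0 T)) (x y : C0 T) :
    stieltjes a (x + y) = stieltjes a x + stieltjes a y := by
  refine tendsto_nhds_unique (tendsto_rsSum ha (x + y)) ?_
  refine ((tendsto_rsSum ha x).add (tendsto_rsSum ha y)).congr fun n => ?_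
  simp only [rsSum, ← Finset.sum_add_distrib, value_add]
  exact Finset.sum_congr rfl fun k _ => by ring

theorem stieltjes_smul {a : ℝ → ℝ} (ha : BoundedVariationOn a (Set.Icc 0 T)) (c : ℝ) (x : C0 T) :
    stieltjes a (c • x) = c * stieltjes a x := by
  refine tendsto_nhds_unique (tendsto_rsSum ha (c • x)) ?_
  refine ((tendsto_rsSum ha x).const_mul c).congr fun n => ?_
  simp only [rsSum, Finset.mul_sum, value_smul]
  exact Finset.sum_congr rfl fun k _ => by ring

theorem measurable_rsSum (a : ℝ → ℝ) (n : ℕ) : Measurable fun x : C0 T => rsSum a x n := by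
  refine Continuous.measurable ?_
  unfold rsSum
  refine continuous_finsetSum _ fun k _ => ?_
  exact ((continuous_value_left _).sub (continuous_value_left _)).const_mul _

theorem measurable_stieltjes (a : ℝ → ℝ) : Measurable (stieltjes a : C0 T → ℝ) :=
  (StronglyMeasurable.limUnder fun n => (measurable_rsSum a n).stronglyMeasurable).measurable

theorem tendsto_rsSum_linear_combination {ι : Type*} (S : Finset ι) (s : ι → ℝ) {a : ι → ℝ → ℝ}
    (ha : ∀ i, BoundedVariationOn (a i) (Set.Icc 0 T)) (x : C0 T) :
    Tendsto (rsSum (fun τ => ∑ i ∈ S, s i * a i τ) x) atTop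
      (𝓝 (∑ i ∈ S, s i * stieltjes (a i) x)) := by
  have : ∀ n, rsSum (fun τ => ∑ i ∈ S, s i * a i τ) x n = ∑ i ∈ S, s i * rsSum (a i) x n := by
    intro n
    simp only [rsSum, Finset.mul_sum, Finset.sum_mul]
    rw [Finset.sum_comm]
    exact Finset.sum_congr rfl fun i _ => Finset.sum_congr rfl fun k _ => by ring
  rw [show rsSum (fun τ => ∑ i ∈ S, s i * a i τ) x = _ from funext this]
  exact tendsto_finsetSum _ fun i _ => (tendsto_rsSum (ha i) x).const_mul _

end GFFT

/-! ### Almost sure convergence of Gaussian series. -/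

namespace GFFT

section GaussianSeries

variable {Ω : Type*} [MeasurableSpace Ω] {P : Measure Ω} [IsProbabilityMeasure P]

theorem map_eq_gaussianReal {X : Ω → ℝ} (hX : AEMeasurable X P) (v : NNReal)
    (h : ∀ t : ℝ, ∫ ω, Complex.exp (Complex.I * (t * X ω : ℝ)) ∂P =
      (Real.exp (-(t ^ 2 * v) / 2) : ℂ)) :
    P.map X = gaussianReal 0 v := by
  have : IsProbabilityMeasure (P.map X) := Measure.isProbabilityMeasure_map hX
  refine Measure.ext_of_charFun (funext fun t => ?_)
  rw [charFun_gaussianReal, charFun_apply_real, integral_map hX (by fun_prop)]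
  have h1 := h t
  push_cast at h1
  rw [show (fun ω => Complex.exp (t * X ω * Complex.I)) =
    fun ω => Complex.exp (Complex.I * (t * X ω)) by ext; ring_nf, h1]
  congr 1
  push_cast
  ring

/-- The crude bound `|X| ≤ 1 + X²` suffices for the uniform `L¹` bound in the martingale convergence
theorem. -/
theorem integrable_and_moments_of_map_eq_gaussianReal {X : Ω → ℝ} (hX : AEMeasurable X P)
    {v : NNReal} (h : P.map X = gaussianReal 0 v) :
    Integrable X P ∧ ∫ ω, X ω ∂P = 0 ∧ eLpNorm X 1 P ≤ ENNReal.ofReal (1 + v) := by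
  have hid : MemLp id 2 (P.map X) := by
    rw [h]
    exact memLp_id_gaussianReal' 2 (by simp)
  have hX2 : MemLp X 2 P := by
    have := (memLp_map_measure_iff (by fun_prop) hX).1 hid
    simpa using this
  have hint : Integrable X P := hX2.integrable (by norm_num)
  have hmean : ∫ ω, X ω ∂P = 0 := by
    have h1 : ∫ y, y ∂(P.map X) = ∫ ω, X ω ∂P := integral_map hX (by fun_prop)
    rw [← h1, h, integral_id_gaussianReal]
  have hsq : ∫ ω, X ω ^ 2 ∂P = v := by
    have h1 : ∫ y, y ^ 2 ∂(P.map X) = ∫ ω, X ω ^ 2 ∂P := integral_map hX (by fun_prop)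
    have h2 := variance_fun_id_gaussianReal (μ := 0) (v := v)
    rw [variance_eq_integral (by fun_prop)] at h2
    simp only [integral_id_gaussianReal, sub_zero] at h2
    rw [← h1, h, h2]
  refine ⟨hint, hmean, ?_⟩
  rw [eLpNorm_one_eq_lintegral_enorm, ← ofReal_integral_norm_eq_lintegral_enorm hint]
  refine ENNReal.ofReal_le_ofReal ?_
  have : ∫ ω, ‖X ω‖ ∂P ≤ ∫ ω, (1 + X ω ^ 2) ∂P := by
    refine integral_mono hint.norm ((integrable_const _).add hX2.integrable_sq) fun ω => ?_
    simp only [Real.norm_eq_abs]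
    nlinarith [sq_abs (X ω), sq_nonneg (|X ω| - 1)]
  refine this.trans (le_of_eq ?_)
  rw [integral_add (integrable_const _) hX2.integrable_sq, hsq]
  simp

/-- A family with the joint characteristic function of i.i.d. centred Gaussian variables is
independent. -/
theorem iIndepFun_of_charFun {ξ : ℕ → Ω → ℝ} (hξ : ∀ j, Measurable (ξ j)) {M : ℝ}
    (h : ∀ (S : Finset ℕ) (s : ℕ → ℝ),
      ∫ ω, Complex.exp (Complex.I * (∑ j ∈ S, s j * ξ j ω : ℝ)) ∂P =
        (Real.exp (-(M ^ 2 * ∑ j ∈ S, s j ^ 2) / 2) : ℂ)) :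
    iIndepFun ξ P := by
  classical
  rw [iIndepFun_iff_finset]
  intro S
  refine (iIndepFun_iff_charFun_pi (X := fun i : S => ξ i)
    (fun i => (hξ i).aemeasurable)).2 fun t => ?_
  have hsingle : ∀ (j : ℕ) (r : ℝ), charFun (P.map (ξ j)) r =
      (Real.exp (-(M ^ 2 * r ^ 2) / 2) : ℂ) := by
    intro j r
    rw [charFun_apply_real, integral_map (hξ j).aemeasurable (by fun_prop)]
    have := h {j} (fun _ => r)
    simp only [Finset.sum_singleton] at this
    rw [← this]
    refine integral_congr_ae (Eventually.of_forall fun ω => ?_)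
    simp only
    push_cast
    ring_nf
  simp_rw [hsingle]
  rw [charFun_apply, integral_map (by fun_prop) (by fun_prop)]
  set s : ℕ → ℝ := fun j => if hj : j ∈ S then t ⟨j, hj⟩ else 0 with hs
  have hst : ∀ i : S, s i = t i := fun i => by simp [hs]
  have := h S s
  rw [← Complex.ofReal_prod, ← Real.exp_sum]
  have e1 : ∑ i : S, -(M ^ 2 * (t i) ^ 2) / 2 = -(M ^ 2 * ∑ j ∈ S, s j ^ 2) / 2 := by
    rw [← Finset.sum_coe_sort S (fun j => s j ^ 2), ← Finset.sum_div, Finset.mul_sum,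
      ← Finset.sum_neg_distrib]
    simp_rw [hst]
  rw [e1, ← this]
  refine integral_congr_ae (Eventually.of_forall fun ω => ?_)
  simp only
  rw [mul_comm]
  congr 3
  rw [← Finset.sum_coe_sort S (fun j => s j * ξ j ω), PiLp.inner_apply]
  simp_rw [hst]
  simp

/-- Almost sure convergence of Gaussian series with square summable coefficients. -/
theorem ae_exists_tendsto_sum {ξ : ℕ → Ω → ℝ} (hξ : ∀ j, Measurable (ξ j)) {M : ℝ}
    (h : ∀ (S : Finset ℕ) (s : ℕ → ℝ),
      ∫ ω, Complex.exp (Complex.I * (∑ j ∈ S, s j * ξ j ω : ℝ)) ∂P =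
        (Real.exp (-(M ^ 2 * ∑ j ∈ S, s j ^ 2) / 2) : ℂ))
    {c : ℕ → ℝ} (hc : Summable fun j => c j ^ 2) :
    ∀ᵐ ω ∂P, ∃ l, Tendsto (fun n => ∑ j ∈ Finset.range n, c j * ξ j ω) atTop (𝓝 l) := by
  have hind := iIndepFun_of_charFun hξ h
  have hlaw : ∀ S : Finset ℕ, Integrable (fun ω => ∑ j ∈ S, c j * ξ j ω) P ∧
      ∫ ω, ∑ j ∈ S, c j * ξ j ω ∂P = 0 ∧
      eLpNorm (fun ω => ∑ j ∈ S, c j * ξ j ω) 1 P ≤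
        ENNReal.ofReal (1 + M ^ 2 * ∑ j ∈ S, c j ^ 2) := by
    intro S
    have hm : Measurable fun ω => ∑ j ∈ S, c j * ξ j ω :=
      Finset.measurable_sum _ fun j _ => (hξ j).const_mul _
    have hnn : 0 ≤ M ^ 2 * ∑ j ∈ S, c j ^ 2 :=
      mul_nonneg (sq_nonneg _) (Finset.sum_nonneg fun _ _ => sq_nonneg _)
    have := map_eq_gaussianReal hm.aemeasurable ⟨_, hnn⟩ (P := P) fun t => by
      have h1 := h S fun j => t * c j
      simp_rw [mul_pow, ← Finset.mul_sum, mul_assoc, ← Finset.mul_sum] at h1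
      rw [h1]
      congr 3
      change _ = -(t ^ 2 * (M ^ 2 * ∑ j ∈ S, c j ^ 2))
      ring
    exact integrable_and_moments_of_map_eq_gaussianReal hm.aemeasurable this
  have hone : ∀ j, Integrable (ξ j) P ∧ ∫ ω, ξ j ω ∂P = 0 := by
    intro j
    have := map_eq_gaussianReal (hξ j).aemeasurable ⟨M ^ 2, sq_nonneg _⟩ (P := P) fun t => by
      have h1 := h {j} fun _ => t
      simp only [Finset.sum_singleton] at h1
      rw [h1]
      congr 3
      change _ = -(t ^ 2 * M ^ 2)
      ring
    have := integrable_and_moments_of_map_eq_gaussianReal (hξ j).aemeasurable this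
    exact ⟨this.1, this.2.1⟩
  set ℱ := Filtration.natural ξ (fun j => (hξ j).stronglyMeasurable)
  -- The shift by one makes `f n` a function of `ξ 0, …, ξ n`, hence adapted to the natural
  -- filtration; it is undone at the end.
  set f : ℕ → Ω → ℝ := fun n ω => ∑ j ∈ Finset.range (n + 1), c j * ξ j ω with hf
  have hmart : Martingale f ℱ P := by
    refine martingale_nat ?_ (fun n => (hlaw _).1) fun n => ?_
    · intro n
      refine Finset.stronglyMeasurable_fun_sum _ fun j hj => ?_
      refine StronglyMeasurable.const_mul ?_ _
      exact (Filtration.stronglyAdapted_natural (fun j => (hξ j).stronglyMeasurable) j).mono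
        (ℱ.mono (by simpa [Nat.lt_succ_iff] using hj))
    · have h1 : f (n + 1) = f n + c (n + 1) • ξ (n + 1) := by
        ext ω
        simp [hf, Finset.sum_range_succ _ (n + 1)]
      have h2 : P[ξ (n + 1) | ℱ n] =ᵐ[P] fun _ => P[ξ (n + 1)] :=
        hind.condExp_natural_ae_eq_of_lt (fun j => (hξ j).stronglyMeasurable) (Nat.lt_succ_self n)
      have h3 : P[f n | ℱ n] = f n := by
        refine condExp_of_stronglyMeasurable (ℱ.le n) ?_ (hlaw _).1
        refine Finset.stronglyMeasurable_fun_sum _ fun j hj => ?_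
        refine StronglyMeasurable.const_mul ?_ _
        exact (Filtration.stronglyAdapted_natural (fun j => (hξ j).stronglyMeasurable) j).mono
          (ℱ.mono (by simpa [Nat.lt_succ_iff] using hj))
      have h4 := condExp_add (hlaw (Finset.range (n + 1))).1
        ((hone (n + 1)).1.smul (c (n + 1))) (ℱ n)
      have h5 := condExp_smul (μ := P) (c (n + 1)) (ξ (n + 1)) (ℱ n)
      rw [h1]
      filter_upwards [h2, h4, h5] with ω g2 g4 g5
      rw [g4, Pi.add_apply, g5, Pi.smul_apply, g2, (hone (n + 1)).2]
      change _ = (P[f n | ℱ n]) ω + _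
      rw [h3]
      simp
  have hconv := hmart.submartingale.exists_ae_tendsto_of_bdd
    (R := (1 + M ^ 2 * ∑' j, c j ^ 2).toNNReal) fun n => by
      refine (hlaw (Finset.range (n + 1))).2.2.trans ?_
      refine ENNReal.ofReal_le_ofReal ?_
      gcongr
      exact hc.sum_le_tsum _ fun _ _ => sq_nonneg _
  filter_upwards [hconv] with ω ⟨l, hl⟩
  exact ⟨l, (tendsto_add_atTop_iff_nat 1).1 hl⟩

end GaussianSeries

end GFFT

/-! ### Laws of the processes `∫ g dW` on path space, and time change. -/

namespace GFFT

set_option linter.unusedSectionVars false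

variable {T : ℝ} [hT : Fact (0 < T)]

theorem Icc_subset_closure_rat :
    Set.Icc (0 : ℝ) T ⊆ closure {t | t ∈ Set.Icc (0 : ℝ) T ∧ ∃ r : ℚ, (r : ℝ) = t} := by
  have h := Dense.open_subset_closure_inter Rat.denseRange_cast (isOpen_Ioo (a := (0 : ℝ)) (b := T))
  have h' := closure_mono h
  rw [closure_closure, closure_Ioo hT.out.ne] at h'
  refine h'.trans ?_
  refine closure_mono ?_
  rintro t ⟨ht, r, rfl⟩
  exact ⟨Set.Ioo_subset_Icc_self ht, r, rfl⟩

/-- Describes closed balls by countably many evaluations, so that they are measurable for the values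
at rational times. -/
theorem dist_le_iff_rat {x y : C0 T} {ρ : ℝ} (hρ : 0 ≤ ρ) :
    dist x y ≤ ρ ↔ ∀ r : ℚ, (r : ℝ) ∈ Set.Icc (0 : ℝ) T → |value x r - value y r| ≤ ρ := by
  rw [Subtype.dist_eq, ContinuousMap.dist_le hρ]
  constructor
  · intro h r _
    exact h _
  · intro h t
    have hcl : IsClosed {t : ℝ | |value x t - value y t| ≤ ρ} :=
      isClosed_le ((uniformContinuous_value x).continuous.sub
        (uniformContinuous_value y).continuous).abs continuous_const
    have hsub : {t | t ∈ Set.Icc (0 : ℝ) T ∧ ∃ r : ℚ, (r : ℝ) = t} ⊆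
        {t : ℝ | |value x t - value y t| ≤ ρ} := by
      rintro t ⟨ht, r, rfl⟩
      exact h r ht
    have := closure_minimal hsub hcl (Icc_subset_closure_rat t.2)
    simpa [value, Real.dist_eq] using this

/-- The Borel σ-algebra of the path space is generated by the values at rational times. -/
theorem measurable_of_value {Ω : Type*} [MeasurableSpace Ω] {f : Ω → C0 T}
    (hf : ∀ r : ℚ, (r : ℝ) ∈ Set.Icc (0 : ℝ) T → Measurable fun ω => value (f ω) r) :
    Measurable f := by
  have hball : ∀ (y : C0 T) (ρ : ℝ), 0 ≤ ρ → MeasurableSet {ω | dist (f ω) y ≤ ρ} := by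
    intro y ρ hρ
    simp_rw [dist_le_iff_rat hρ]
    rw [Set.ofPred_forall]
    refine MeasurableSet.iInter fun r => ?_
    by_cases hr : (r : ℝ) ∈ Set.Icc (0 : ℝ) T
    · simp only [hr, forall_true_left]
      exact measurableSet_le ((hf r hr).sub_const _).abs measurable_const
    · simp [hr]
  refine measurable_of_isOpen fun U hU => ?_
  have hU' : f ⁻¹' U = ⋃ (n : ℕ) (q : ℚ) (_ : (0 : ℝ) ≤ q ∧
      Metric.closedBall (TopologicalSpace.denseSeq (C0 T) n) q ⊆ U),
      {ω | dist (f ω) (TopologicalSpace.denseSeq (C0 T) n) ≤ q} := by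
    ext ω
    simp only [Set.mem_preimage, Set.mem_iUnion, Set.mem_ofPred_eq, exists_prop]
    constructor
    · intro hω
      obtain ⟨ε, hε, hsub⟩ := Metric.isOpen_iff.1 hU _ hω
      obtain ⟨q, hq0, hq1⟩ := exists_rat_btwn (half_pos hε)
      obtain ⟨n, hn⟩ := (TopologicalSpace.denseRange_denseSeq (C0 T)).exists_dist_lt (f ω) hq0
      refine ⟨n, q, ⟨hq0.le, fun z hz => hsub ?_⟩, hn.le⟩
      rw [Metric.mem_ball]
      have := dist_triangle z (TopologicalSpace.denseSeq (C0 T) n) (f ω)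
      rw [dist_comm (TopologicalSpace.denseSeq (C0 T) n)] at this
      have hz' := Metric.mem_closedBall.1 hz
      linarith
    · rintro ⟨n, q, ⟨-, hsub⟩, hd⟩
      exact hsub hd
  rw [hU']
  exact MeasurableSet.iUnion fun n => MeasurableSet.iUnion fun q =>
    MeasurableSet.iUnion fun h => hball _ _ h.1

/-- `ν` is the law of the process `∫_0^t g dW`, expressed by characteristic functions. -/
def HasVarianceDensity (ν : Measure (C0 T)) (g : ℝ → ℝ) : Prop :=
  ∀ (ι : Type) [Fintype ι] (s t : ι → ℝ), (∀ i, t i ∈ Set.Icc 0 T) →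
    ∫ x, Complex.exp (Complex.I * (∑ i, s i * value x (t i) : ℝ)) ∂ν =
      (Real.exp (-(∫ τ in Set.Icc 0 T,
        (∑ i, s i * (Set.Icc 0 (t i)).indicator (fun _ => (1 : ℝ)) τ) ^ 2 * g τ ^ 2) / 2) : ℂ)

/-- A measurable function on `[0,T]` that is essentially bounded by `M`. -/
structure IsEssBounded (T : ℝ) (g : ℝ → ℝ) (M : ℝ) : Prop where
  meas : AEStronglyMeasurable g (volume.restrict (Set.Icc 0 T))
  bound : ∀ᵐ τ ∂(volume.restrict (Set.Icc 0 T)), |g τ| ≤ M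
  pos : 0 < M

variable {g : ℝ → ℝ} {M : ℝ}

theorem IsEssBounded.integrable_sq (hg : IsEssBounded T g M) :
    Integrable (fun τ => g τ ^ 2) (volume.restrict (Set.Icc 0 T)) := by
  refine Integrable.of_bound (hg.meas.pow 2) (M ^ 2) ?_
  filter_upwards [hg.bound] with τ h
  rw [Real.norm_of_nonneg (sq_nonneg _), ← sq_abs]
  gcongr

/-- `∫_0^t g²`. -/
def varianceClock (T : ℝ) (g : ℝ → ℝ) (t : ℝ) : ℝ :=
  ∫ τ in Set.Icc 0 T, (Set.Icc 0 t).indicator (fun _ => (1 : ℝ)) τ * g τ ^ 2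

theorem integrable_indicator_mul_sq (hg : IsEssBounded T g M) (t : ℝ) :
    Integrable (fun τ => (Set.Icc 0 t).indicator (fun _ => (1 : ℝ)) τ * g τ ^ 2)
      (volume.restrict (Set.Icc 0 T)) := by
  refine hg.integrable_sq.bdd_mul (c := 1)
    ((measurable_const.indicator measurableSet_Icc).aestronglyMeasurable)
    (Eventually.of_forall fun τ => ?_)
  by_cases h : τ ∈ Set.Icc 0 t <;> simp [h]

theorem varianceClock_mono (hg : IsEssBounded T g M) : Monotone (varianceClock T g) := by
  intro s t hst
  refine integral_mono (integrable_indicator_mul_sq hg s) (integrable_indicator_mul_sq hg t)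
    fun τ => ?_
  refine mul_le_mul_of_nonneg_right ?_ (sq_nonneg _)
  exact Set.indicator_le_indicator_of_subset (Set.Icc_subset_Icc_right hst)
    (fun _ => zero_le_one) τ

theorem varianceClock_nonneg (t : ℝ) : 0 ≤ varianceClock T g t := by
  refine integral_nonneg fun τ => mul_nonneg ?_ (sq_nonneg _)
  exact Set.indicator_nonneg (by simp) τ

theorem continuous_varianceClock (hg : IsEssBounded T g M) : Continuous (varianceClock T g) := by
  refine continuous_iff_continuousAt.2 fun t => ?_
  refine tendsto_integral_filter_of_dominated_convergence (fun τ => g τ ^ 2)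
    (Eventually.of_forall fun s => (integrable_indicator_mul_sq hg s).1) ?_ hg.integrable_sq ?_
  · refine Eventually.of_forall fun s => Eventually.of_forall fun τ => ?_
    by_cases h : τ ∈ Set.Icc 0 s <;> simp [h, sq_nonneg]
  · have : ∀ᵐ τ ∂(volume.restrict (Set.Icc 0 T)), τ ≠ t :=
      Measure.ae_ne _ _
    filter_upwards [this] with τ hτ
    refine Tendsto.mul_const _ ?_
    refine tendsto_nhds_of_eventually_eq ?_
    rcases lt_or_gt_of_ne hτ with h | h
    · filter_upwards [lt_mem_nhds h] with s hs
      by_cases h0 : 0 ≤ τ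
      · simp [Set.indicator, h0, hs.le, h.le]
      · simp [Set.indicator, h0]
    · filter_upwards [gt_mem_nhds h] with s hs
      simp [Set.indicator, not_le.2 hs, not_le.2 h]

theorem varianceClock_zero : varianceClock T g 0 = 0 := by
  unfold varianceClock
  refine integral_eq_zero_of_ae ?_
  have : ∀ᵐ τ ∂(volume.restrict (Set.Icc 0 T)), τ ≠ 0 := Measure.ae_ne _ _
  filter_upwards [this] with τ hτ
  simp [hτ]

theorem varianceClock_le (hg : IsEssBounded T g M) (t : ℝ) : varianceClock T g t ≤ M ^ 2 * T := by
  calc varianceClock T g t ≤ ∫ τ in Set.Icc 0 T, M ^ 2 := by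
        refine integral_mono_ae (integrable_indicator_mul_sq hg t) (integrable_const _) ?_
        filter_upwards [hg.bound] with τ h
        have : g τ ^ 2 ≤ M ^ 2 := by
          rw [← sq_abs]
          gcongr
        by_cases hτ : τ ∈ Set.Icc 0 t
        · simpa [hτ] using this
        · simp [hτ, sq_nonneg]
    _ = M ^ 2 * T := by
        simp [mul_comm, hT.out.le]

/-- Since `1_[0,s] 1_[0,t] = 1_[0,min s t]`, the variance in `HasVarianceDensity` is the quadratic
form of the covariance `∫_0^{min s t} g²`. -/
theorem integral_sq_sum_indicator (hg : IsEssBounded T g M) {ι : Type} [Fintype ι] (s t : ι → ℝ) :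
    ∫ τ in Set.Icc 0 T,
      (∑ i, s i * (Set.Icc 0 (t i)).indicator (fun _ => (1 : ℝ)) τ) ^ 2 * g τ ^ 2 =
    ∑ i, ∑ j, s i * s j * varianceClock T g (min (t i) (t j)) := by
  have h1 : ∀ τ : ℝ, (∑ i, s i * (Set.Icc 0 (t i)).indicator (fun _ => (1 : ℝ)) τ) ^ 2 * g τ ^ 2 =
      ∑ i, ∑ j, s i * s j *
        ((Set.Icc 0 (min (t i) (t j))).indicator (fun _ => (1 : ℝ)) τ * g τ ^ 2) := by
    intro τ
    rw [sq, Finset.sum_mul_sum, Finset.sum_mul]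
    refine Finset.sum_congr rfl fun i _ => ?_
    rw [Finset.sum_mul]
    refine Finset.sum_congr rfl fun j _ => ?_
    have : (Set.Icc 0 (min (t i) (t j))).indicator (fun _ => (1 : ℝ)) τ =
        (Set.Icc 0 (t i)).indicator (fun _ => (1 : ℝ)) τ *
          (Set.Icc 0 (t j)).indicator (fun _ => (1 : ℝ)) τ := by
      simp only [Set.indicator, Set.mem_Icc, le_min_iff]
      split_ifs <;> simp_all
    rw [this]
    ring
  simp_rw [h1]
  rw [integral_finsetSum]
  · refine Finset.sum_congr rfl fun i _ => ?_
    rw [integral_finsetSum]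
    · refine Finset.sum_congr rfl fun j _ => ?_
      rw [integral_const_mul]
      rfl
    · exact fun j _ => (integrable_indicator_mul_sq hg _).const_mul _
  · exact fun i _ => integrable_finsetSum _ fun j _ =>
      (integrable_indicator_mul_sq hg _).const_mul _

theorem integral_exp_sum_value {𝔪 : Measure (C0 T)} (h𝔪 : IsWienerMeasure 𝔪) {ι : Type}
    [Fintype ι] (s t : ι → ℝ) (ht : ∀ i, t i ∈ Set.Icc 0 T) :
    ∫ x, Complex.exp (Complex.I * (∑ i, s i * value x (t i) : ℝ)) ∂𝔪 =
      (Real.exp (-(∑ i, ∑ j, s i * s j * min (t i) (t j)) / 2) : ℂ) := by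
  have := h𝔪.isProbabilityMeasure
  have hG : HasGaussianLaw (fun x : C0 T => ∑ i, s i * value x (t i)) 𝔪 :=
    ((h𝔪.isGaussianProcess.comp_right (fun i : ι => (⟨t i, ht i⟩ : Set.Icc (0 : ℝ) T))).smul
      s).hasGaussianLaw_fun_sum (I := Finset.univ)
  have hval : ∀ i, HasGaussianLaw (fun x : C0 T => value x (t i)) 𝔪 := fun i =>
    h𝔪.isGaussianProcess.hasGaussianLaw_eval (⟨t i, ht i⟩ : Set.Icc (0 : ℝ) T)
  have hmean : ∫ x, ∑ i, s i * value x (t i) ∂𝔪 = 0 := by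
    rw [integral_finsetSum _ fun i _ => (hval i).integrable.const_mul _]
    refine Finset.sum_eq_zero fun i _ => ?_
    rw [integral_const_mul, h𝔪.mean _ (ht i), mul_zero]
  have hvar : Var[fun x : C0 T => ∑ i, s i * value x (t i); 𝔪] =
      ∑ i, ∑ j, s i * s j * min (t i) (t j) := by
    rw [variance_eq_integral hG.aemeasurable, hmean]
    simp only [sub_zero]
    have h1 : ∀ x : C0 T, (∑ i, s i * value x (t i)) ^ 2 =
        ∑ i, ∑ j, s i * s j * (value x (t i) * value x (t j)) := by
      intro x
      rw [sq, Finset.sum_mul_sum]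
      exact Finset.sum_congr rfl fun i _ => Finset.sum_congr rfl fun j _ => by ring
    have hint : ∀ i j, Integrable (fun x : C0 T => value x (t i) * value x (t j)) 𝔪 := fun i j =>
      (hval i).memLp_two.integrable_mul (hval j).memLp_two
    simp_rw [h1]
    rw [integral_finsetSum _ fun i _ => integrable_finsetSum _ fun j _ => (hint i j).const_mul _]
    refine Finset.sum_congr rfl fun i _ => ?_
    rw [integral_finsetSum _ fun j _ => (hint i j).const_mul _]
    refine Finset.sum_congr rfl fun j _ => ?_
    rw [integral_const_mul, h𝔪.covariance _ (ht i) _ (ht j)]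
  have h1 := hG.charFun_map_eq (1 : ℝ)
  rw [charFun_apply_real, integral_map hG.aemeasurable (by fun_prop)] at h1
  simp only [RCLike.inner_apply, conj_trivial, mul_one] at h1
  rw [hmean, hvar] at h1
  have h2 : ∀ x : C0 T, Complex.exp (Complex.I * (∑ i, s i * value x (t i) : ℝ)) =
      Complex.exp ((1 : ℝ) * (∑ i, s i * value x (t i) : ℝ) * Complex.I) := by
    intro x
    rw [Complex.ofReal_one, one_mul, mul_comm]
  simp_rw [h2]
  rw [h1]
  push_cast
  congr 1
  simp [neg_div]

theorem isEssBounded_one : IsEssBounded T (fun _ => (1 : ℝ)) 1 :=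
  ⟨aestronglyMeasurable_const, Eventually.of_forall fun _ => by simp, one_pos⟩

theorem IsWienerMeasure.hasVarianceDensity {𝔪 : Measure (C0 T)} (h𝔪 : IsWienerMeasure 𝔪) :
    HasVarianceDensity 𝔪 fun _ => 1 := by
  intro ι _ s t ht
  rw [integral_exp_sum_value h𝔪 s t ht, integral_sq_sum_indicator isEssBounded_one]
  refine congrArg (fun r : ℝ => ((Real.exp (-r / 2) : ℝ) : ℂ)) ?_
  refine Finset.sum_congr rfl fun i _ => Finset.sum_congr rfl fun j _ => ?_
  congr 1
  have h0 : 0 ≤ min (t i) (t j) := le_min (ht i).1 (ht j).1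
  have h1 : min (t i) (t j) ≤ T := (min_le_left _ _).trans (ht i).2
  simp only [varianceClock, one_pow, mul_one]
  rw [integral_indicator measurableSet_Icc, Measure.restrict_restrict measurableSet_Icc,
    Set.inter_eq_left.2 (Set.Icc_subset_Icc_right h1)]
  simp [h0]

/-- The path `t ↦ M x(β(t) / M²)` with the clock `β(t) = ∫_0^t g²`. -/
def timeChange (hg : IsEssBounded T g M) (x : C0 T) : C0 T :=
  ⟨⟨fun t => M * value x (varianceClock T g t / M ^ 2),
    continuous_const.mul ((uniformContinuous_value x).continuous.comp
      (((continuous_varianceClock hg).comp continuous_subtype_val).div_const _))⟩, by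
    change M * value x (varianceClock T g 0 / M ^ 2) = 0
    rw [varianceClock_zero, zero_div]
    have : value x 0 = 0 := by
      have := x.2
      simp only [value, Set.projIcc_left]
      exact this
    rw [this, mul_zero]⟩

theorem value_timeChange (hg : IsEssBounded T g M) (x : C0 T) {t : ℝ} (ht : t ∈ Set.Icc 0 T) :
    value (timeChange hg x) t = M * value x (varianceClock T g t / M ^ 2) := by
  change M * value x (varianceClock T g (Set.projIcc 0 T hT.out.le t) / M ^ 2) = _
  rw [Set.projIcc_of_mem _ ht]

theorem measurable_timeChange (hg : IsEssBounded T g M) : Measurable (timeChange hg) := by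
  refine measurable_of_value fun r hr => ?_
  simp_rw [value_timeChange hg _ hr]
  exact (continuous_value_left _).measurable.const_mul _

/-- A monotone clock commutes with `min`, so the covariance of the time-changed path is `M² · β(min
s t) / M²`. Division by `M²` keeps the clock inside `[0,T]`, because `β ≤ M² T`. This is a process
with continuous paths and the law expected of `∫ g dW`. -/
theorem hasVarianceDensity_map_timeChange {𝔪 : Measure (C0 T)} (h𝔪 : IsWienerMeasure 𝔪)
    (hg : IsEssBounded T g M) : HasVarianceDensity (𝔪.map (timeChange hg)) g := by
  intro ι _ s t ht
  have hM := hg.pos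
  rw [integral_map (measurable_timeChange hg).aemeasurable]
  · have h1 : ∀ x : C0 T, ∑ i, s i * value (timeChange hg x) (t i) =
        ∑ i, (s i * M) * value x (varianceClock T g (t i) / M ^ 2) := by
      intro x
      refine Finset.sum_congr rfl fun i _ => ?_
      rw [value_timeChange hg x (ht i)]
      ring
    simp_rw [h1]
    rw [integral_exp_sum_value h𝔪, integral_sq_sum_indicator hg]
    · refine congrArg (fun r : ℝ => ((Real.exp (-r / 2) : ℝ) : ℂ)) ?_
      refine Finset.sum_congr rfl fun i _ => Finset.sum_congr rfl fun j _ => ?_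
      rw [min_div_div_right (by positivity : (0 : ℝ) ≤ M ^ 2), ← (varianceClock_mono hg).map_min]
      field_simp
    · intro i
      refine ⟨div_nonneg (varianceClock_nonneg _) (by positivity), ?_⟩
      rw [div_le_iff₀ (by positivity), mul_comm]
      exact varianceClock_le hg _
  · refine Continuous.aestronglyMeasurable ?_
    have : Continuous fun x : C0 T => ∑ i, s i * value x (t i) :=
      continuous_finsetSum _ fun i _ => (continuous_value_left _).const_mul _
    fun_prop

end GFFT

/-! ### Characteristic functions of Stieltjes integrals. -/

namespace GFFT

set_option linter.unusedSectionVars false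

variable {T : ℝ} [hT : Fact (0 < T)] {g : ℝ → ℝ} {M : ℝ}

/-- The left-endpoint step function of `a` on the uniform partition into `n` intervals. -/
def stepFun (T : ℝ) (a : ℝ → ℝ) (n : ℕ) (τ : ℝ) : ℝ :=
  ∑ k ∈ Finset.range n, a (k * T / n) *
    ((Set.Icc 0 ((k + 1) * T / n)).indicator (fun _ => (1 : ℝ)) τ -
      (Set.Icc 0 (k * T / n)).indicator (fun _ => (1 : ℝ)) τ)

theorem measurable_stepFun (a : ℝ → ℝ) (n : ℕ) : Measurable (stepFun T a n) := by
  unfold stepFun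
  refine Finset.measurable_sum _ fun k _ => Measurable.const_mul ?_ _
  exact (measurable_const.indicator measurableSet_Icc).sub
    (measurable_const.indicator measurableSet_Icc)

theorem exists_stepFun_eq (a : ℝ → ℝ) {n : ℕ} (hn : 0 < n) {τ : ℝ} (h0 : 0 < τ) (h1 : τ ≤ T) :
    ∃ σ ∈ Set.Icc 0 T, |σ - τ| ≤ T / n ∧ stepFun T a n τ = a σ := by
  have hT0 := hT.out
  have hn' : (0 : ℝ) < n := by exact_mod_cast hn
  have hc : 0 < τ * n / T := by positivity
  -- The difference of the two indicators lives on cells open on the left and closed on the right;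
  -- this is why the cell index is a ceiling minus one and `τ = 0` is excluded.
  obtain ⟨k, hk⟩ : ∃ k, ⌈τ * n / T⌉₊ = k + 1 :=
    Nat.exists_eq_succ_of_ne_zero (Nat.ceil_pos.2 hc).ne'
  have hk1 : (k : ℝ) < τ * n / T := by
    have : k < ⌈τ * n / T⌉₊ := by omega
    exact Nat.lt_ceil.1 this
  have hk2 : τ * n / T ≤ k + 1 := by
    have := Nat.le_ceil (τ * n / T)
    rw [hk] at this
    exact_mod_cast this
  have hkn : k < n := by
    have : τ * n / T ≤ n := by
      rw [div_le_iff₀ hT0, mul_comm]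
      gcongr
    have h2 : (k : ℝ) < n := hk1.trans_le this
    exact_mod_cast h2
  have hk1' : k * T / n < τ := by
    rw [lt_div_iff₀ hT0] at hk1
    rwa [div_lt_iff₀ hn']
  have hk2' : τ ≤ (k + 1) * T / n := by
    rw [div_le_iff₀ hT0] at hk2
    rwa [le_div_iff₀ hn']
  refine ⟨k * T / n, ⟨by positivity, hk1'.le.trans h1⟩, ?_, ?_⟩
  · rw [abs_sub_comm, abs_of_pos (by linarith)]
    have : (k + 1) * T / n = k * T / n + T / n := by ring
    linarith
  · rw [stepFun, Finset.sum_eq_single k]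
    · simp [Set.indicator, h0.le, hk2', not_le.2 hk1']
    · intro j _ hjk
      rcases lt_or_gt_of_ne hjk with h | h
      · have h3 : (j : ℝ) + 1 ≤ k := by exact_mod_cast h
        have h4 : (j + 1) * T / n < τ := lt_of_le_of_lt (by gcongr) hk1'
        have h5 : j * T / n < τ := lt_of_le_of_lt (by gcongr; linarith) h4
        simp [Set.indicator, not_le.2 h4, not_le.2 h5]
      · have h3 : (k : ℝ) + 1 ≤ j := by exact_mod_cast h
        have h4 : τ ≤ j * T / n := hk2'.trans (by gcongr)
        have h5 : τ ≤ (j + 1) * T / n := h4.trans (by gcongr; linarith)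
        simp [Set.indicator, h4, h5, h0.le]
    · intro hk'
      exact absurd (Finset.mem_range.2 hkn) hk'

theorem ae_restrict_pos :
    ∀ᵐ τ ∂(volume.restrict (Set.Icc 0 T)), 0 < τ ∧ τ ≤ T := by
  have h1 : ∀ᵐ τ ∂(volume.restrict (Set.Icc 0 T)), τ ≠ 0 := Measure.ae_ne _ _
  filter_upwards [h1, ae_restrict_mem measurableSet_Icc] with τ h h'
  exact ⟨lt_of_le_of_ne h'.1 h.symm, h'.2⟩

theorem ae_tendsto_stepFun {a : ℝ → ℝ}
    (ha : ∀ᵐ τ ∂(volume.restrict (Set.Icc 0 T)), ContinuousWithinAt a (Set.Icc 0 T) τ) :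
    ∀ᵐ τ ∂(volume.restrict (Set.Icc 0 T)),
      Tendsto (fun n => stepFun T a n τ) atTop (𝓝 (a τ)) := by
  filter_upwards [ha, ae_restrict_pos] with τ hτ h
  rw [Metric.tendsto_atTop]
  intro ε hε
  obtain ⟨δ, hδ, hd⟩ := Metric.continuousWithinAt_iff.1 hτ ε hε
  obtain ⟨N, hN⟩ := exists_nat_gt (T / δ)
  refine ⟨N + 1, fun n hn => ?_⟩
  obtain ⟨σ, hσ, h1, h2⟩ := exists_stepFun_eq (T := T) a (n := n) (by omega) h.1 h.2
  rw [h2]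
  refine hd hσ ?_
  rw [Real.dist_eq]
  refine h1.trans_lt ?_
  have hn' : (0 : ℝ) < n := by
    have : 0 < n := by omega
    exact_mod_cast this
  rw [div_lt_iff₀ hn', mul_comm, ← div_lt_iff₀ hδ]
  refine hN.trans ?_
  exact_mod_cast hn

theorem norm_exp_I_mul_ofReal (r : ℝ) : ‖Complex.exp (Complex.I * (r : ℂ))‖ = 1 := by
  rw [mul_comm, Complex.norm_exp_ofReal_mul_I]

theorem HasVarianceDensity.integral_exp_rsSum {ν : Measure (C0 T)} (hν : HasVarianceDensity ν g)
    (a : ℝ → ℝ) (n : ℕ) :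
    ∫ x, Complex.exp (Complex.I * (rsSum a x n : ℝ)) ∂ν =
      (Real.exp (-(∫ τ in Set.Icc 0 T, stepFun T a n τ ^ 2 * g τ ^ 2) / 2) : ℂ) := by
  have hT0 := hT.out
  -- Each increment uses two values of the path, one for each summand of the index type.
  have h := hν (Fin n ⊕ Fin n)
    (Sum.elim (fun k => a (k * T / n)) (fun k => -a (k * T / n)))
    (Sum.elim (fun k => (k + 1) * T / n) (fun k => k * T / n)) (by
      rintro (k | k)
      · have hn' : (0 : ℝ) < n := by exact_mod_cast k.pos
        have hk : ((k : ℕ) : ℝ) + 1 ≤ n := by exact_mod_cast k.2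
        refine ⟨by simp only [Sum.elim_inl]; positivity, ?_⟩
        simp only [Sum.elim_inl]
        rw [div_le_iff₀ hn', mul_comm]
        gcongr
      · have hn' : (0 : ℝ) < n := by exact_mod_cast k.pos
        have hk : ((k : ℕ) : ℝ) ≤ n := by exact_mod_cast k.2.le
        refine ⟨by simp only [Sum.elim_inr]; positivity, ?_⟩
        simp only [Sum.elim_inr]
        rw [div_le_iff₀ hn', mul_comm]
        gcongr)
  simp only [Fintype.sum_sum_type, Sum.elim_inl, Sum.elim_inr, ← Finset.sum_add_distrib] at h
  have e1 : ∀ x : C0 T, rsSum a x n = ∑ k : Fin n, (a (k * T / n) * value x ((k + 1) * T / n) +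
      -a (k * T / n) * value x (k * T / n)) := by
    intro x
    rw [rsSum, Finset.sum_range]
    exact Finset.sum_congr rfl fun k _ => by ring
  have e2 : ∀ τ : ℝ, stepFun T a n τ = ∑ k : Fin n, (a (k * T / n) *
      (Set.Icc 0 ((k + 1) * T / n)).indicator (fun _ => (1 : ℝ)) τ +
      -a (k * T / n) * (Set.Icc 0 (k * T / n)).indicator (fun _ => (1 : ℝ)) τ) := by
    intro τ
    rw [stepFun, Finset.sum_range]
    exact Finset.sum_congr rfl fun k _ => by ring
  simp_rw [e1, e2]
  exact h

/-- Dominated convergence on both sides of the formula for Riemann–Stieltjes sums. Almost everywhere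
continuity of `a` makes its step functions converge almost everywhere. -/
theorem HasVarianceDensity.integral_exp_of_tendsto {ν : Measure (C0 T)} [IsProbabilityMeasure ν]
    (hν : HasVarianceDensity ν g) (hg : IsEssBounded T g M) {a : ℝ → ℝ} {C : ℝ}
    (haC : ∀ τ ∈ Set.Icc 0 T, |a τ| ≤ C)
    (hac : ∀ᵐ τ ∂(volume.restrict (Set.Icc 0 T)), ContinuousWithinAt a (Set.Icc 0 T) τ)
    {L : C0 T → ℝ} (hL : ∀ x, Tendsto (rsSum a x) atTop (𝓝 (L x))) :
    ∫ x, Complex.exp (Complex.I * (L x : ℝ)) ∂ν =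
      (Real.exp (-(∫ τ in Set.Icc 0 T, a τ ^ 2 * g τ ^ 2) / 2) : ℂ) := by
  have hC : 0 ≤ C := (abs_nonneg _).trans (haC 0 ⟨le_rfl, hT.out.le⟩)
  have h1 : Tendsto (fun n => ∫ x, Complex.exp (Complex.I * (rsSum a x n : ℝ)) ∂ν) atTop
      (𝓝 (∫ x, Complex.exp (Complex.I * (L x : ℝ)) ∂ν)) := by
    refine tendsto_integral_of_dominated_convergence (fun _ => 1) (fun n => ?_)
      (integrable_const _) (fun n => Eventually.of_forall fun x => ?_)
      (Eventually.of_forall fun x => ?_)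
    · have := measurable_rsSum (T := T) a n
      fun_prop
    · rw [norm_exp_I_mul_ofReal]
    · refine (Complex.continuous_exp.tendsto _).comp (Tendsto.const_mul _ ?_)
      exact (Complex.continuous_ofReal.tendsto _).comp (hL x)
  have h2 : Tendsto (fun n => ∫ τ in Set.Icc 0 T, stepFun T a n τ ^ 2 * g τ ^ 2) atTop
      (𝓝 (∫ τ in Set.Icc 0 T, a τ ^ 2 * g τ ^ 2)) := by
    refine tendsto_integral_filter_of_dominated_convergence (fun τ => C ^ 2 * g τ ^ 2)
      (Eventually.of_forall fun n => ?_) ?_ (hg.integrable_sq.const_mul _) ?_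
    · exact ((measurable_stepFun a n).pow_const 2).aestronglyMeasurable.mul (hg.meas.pow 2)
    · filter_upwards [eventually_gt_atTop 0] with n hn
      filter_upwards [ae_restrict_pos] with τ hτ
      obtain ⟨σ, hσ, -, h⟩ := exists_stepFun_eq (T := T) a hn hτ.1 hτ.2
      rw [h, Real.norm_of_nonneg (by positivity)]
      have := haC σ hσ
      have h3 : a σ ^ 2 ≤ C ^ 2 := by
        rw [← sq_abs]
        gcongr
      gcongr
    · filter_upwards [ae_tendsto_stepFun hac] with τ hτ
      exact (hτ.pow 2).mul_const _
  refine tendsto_nhds_unique h1 ?_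
  simp_rw [hν.integral_exp_rsSum a]
  refine (Complex.continuous_ofReal.tendsto _).comp ((Real.continuous_exp.tendsto _).comp ?_)
  exact (h2.neg).div_const 2

theorem BoundedVariationOn.exists_bound {a : ℝ → ℝ} (ha : BoundedVariationOn a (Set.Icc 0 T)) :
    ∃ C, ∀ τ ∈ Set.Icc 0 T, |a τ| ≤ C := by
  refine ⟨|a 0| + (eVariationOn a (Set.Icc 0 T)).toReal, fun τ hτ => ?_⟩
  have h := ha.dist_le hτ (⟨le_rfl, hT.out.le⟩ : (0 : ℝ) ∈ Set.Icc 0 T)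
  rw [Real.dist_eq] at h
  have := abs_sub_abs_le_abs_sub (a τ) (a 0)
  linarith

theorem BoundedVariationOn.ae_continuousWithinAt {a : ℝ → ℝ}
    (ha : BoundedVariationOn a (Set.Icc 0 T)) :
    ∀ᵐ τ ∂(volume.restrict (Set.Icc 0 T)), ContinuousWithinAt a (Set.Icc 0 T) τ := by
  rw [ae_restrict_iff' measurableSet_Icc]
  filter_upwards [ha.locallyBoundedVariationOn.ae_differentiableWithinAt_of_mem] with τ h hτ
  exact (h hτ).continuousWithinAt

theorem BoundedVariationOn.aestronglyMeasurable {a : ℝ → ℝ}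
    (ha : BoundedVariationOn a (Set.Icc 0 T)) :
    AEStronglyMeasurable a (volume.restrict (Set.Icc 0 T)) :=
  aestronglyMeasurable_of_tendsto_ae atTop
    (fun n => (measurable_stepFun (T := T) a n).aestronglyMeasurable)
    (ae_tendsto_stepFun (BoundedVariationOn.ae_continuousWithinAt ha))

theorem BoundedVariationOn.memLp_two {a : ℝ → ℝ} (ha : BoundedVariationOn a (Set.Icc 0 T)) :
    MemLp a 2 (volume.restrict (Set.Icc 0 T)) := by
  obtain ⟨C, hC⟩ := BoundedVariationOn.exists_bound ha
  refine MemLp.of_bound (BoundedVariationOn.aestronglyMeasurable ha) C ?_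
  filter_upwards [ae_restrict_mem measurableSet_Icc] with τ hτ
  exact hC τ hτ

variable {α : ℕ → ℝ → ℝ}

theorem HasVarianceDensity.integral_exp_sum_stieltjes {ν : Measure (C0 T)} [IsProbabilityMeasure ν]
    (hν : HasVarianceDensity ν g) (hg : IsEssBounded T g M) (hα : IsCompleteOrthonormalBV T α)
    (S : Finset ℕ) (s : ℕ → ℝ) :
    ∫ x, Complex.exp (Complex.I * (∑ j ∈ S, s j * stieltjes (α j) x : ℝ)) ∂ν =
      (Real.exp (-(∫ τ in Set.Icc 0 T, (∑ j ∈ S, s j * α j τ) ^ 2 * g τ ^ 2) / 2) : ℂ) := by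
  choose C hC using fun j => BoundedVariationOn.exists_bound (hα.boundedVariation j)
  refine hν.integral_exp_of_tendsto hg (C := ∑ j ∈ S, |s j| * C j) ?_ ?_
    (tendsto_rsSum_linear_combination S s hα.boundedVariation)
  · intro τ hτ
    refine (Finset.abs_sum_le_sum_abs _ _).trans (Finset.sum_le_sum fun j _ => ?_)
    rw [abs_mul]
    exact mul_le_mul_of_nonneg_left (hC j τ hτ) (abs_nonneg _)
  · have : ∀ᵐ τ ∂(volume.restrict (Set.Icc 0 T)), ∀ j,
        ContinuousWithinAt (α j) (Set.Icc 0 T) τ :=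
      ae_all_iff.2 fun j => BoundedVariationOn.ae_continuousWithinAt (hα.boundedVariation j)
    filter_upwards [this] with τ h
    exact tendsto_finsetSum _ fun j _ => (h j).tendsto.const_mul (s j)

theorem IsCompleteOrthonormalBV.integrable_mul (hα : IsCompleteOrthonormalBV T α) (i j : ℕ) :
    Integrable (fun τ => α i τ * α j τ) (volume.restrict (Set.Icc 0 T)) :=
  (BoundedVariationOn.memLp_two (hα.boundedVariation i)).integrable_mul
    (BoundedVariationOn.memLp_two (hα.boundedVariation j))

theorem IsCompleteOrthonormalBV.integral_sq_sum (hα : IsCompleteOrthonormalBV T α)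
    (S : Finset ℕ) (s : ℕ → ℝ) :
    ∫ τ in Set.Icc 0 T, (∑ j ∈ S, s j * α j τ) ^ 2 = ∑ j ∈ S, s j ^ 2 := by
  have h1 : ∀ τ : ℝ, (∑ j ∈ S, s j * α j τ) ^ 2 =
      ∑ i ∈ S, ∑ j ∈ S, s i * s j * (α i τ * α j τ) := by
    intro τ
    rw [sq, Finset.sum_mul_sum]
    exact Finset.sum_congr rfl fun i _ => Finset.sum_congr rfl fun j _ => by ring
  simp_rw [h1]
  rw [integral_finsetSum _ fun i _ => integrable_finsetSum _ fun j _ =>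
    (hα.integrable_mul i j).const_mul _]
  refine Finset.sum_congr rfl fun i hi => ?_
  rw [integral_finsetSum _ fun j _ => (hα.integrable_mul i j).const_mul _]
  simp_rw [integral_const_mul, hα.orthonormal]
  simp [hi, sq]

theorem IsCompleteOrthonormalBV.memLp_sum (hα : IsCompleteOrthonormalBV T α)
    (S : Finset ℕ) (s : ℕ → ℝ) :
    MemLp (fun τ => ∑ j ∈ S, s j * α j τ) 2 (volume.restrict (Set.Icc 0 T)) :=
  memLp_finsetSum _ fun j _ =>
    (BoundedVariationOn.memLp_two (hα.boundedVariation j)).const_mul (s j)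

theorem IsEssBounded.integrable_sq_mul_sq (hg : IsEssBounded T g M) {a : ℝ → ℝ}
    (ha : MemLp a 2 (volume.restrict (Set.Icc 0 T))) :
    Integrable (fun τ => a τ ^ 2 * g τ ^ 2) (volume.restrict (Set.Icc 0 T)) := by
  refine ha.integrable_sq.mul_bdd (c := M ^ 2) (hg.meas.pow 2) ?_
  filter_upwards [hg.bound] with τ h
  rw [Real.norm_of_nonneg (sq_nonneg _), ← sq_abs]
  gcongr

/-- The function `g'` with `g² + g'² = M²`. -/
def complementaryDensity (g : ℝ → ℝ) (M : ℝ) (τ : ℝ) : ℝ := √(M ^ 2 - g τ ^ 2)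

theorem IsEssBounded.complementary (hg : IsEssBounded T g M) :
    IsEssBounded T (complementaryDensity g M) M := by
  refine ⟨?_, ?_, hg.pos⟩
  · exact Real.continuous_sqrt.comp_aestronglyMeasurable
      (aestronglyMeasurable_const.sub (hg.meas.pow 2))
  · refine Eventually.of_forall fun τ => ?_
    rw [complementaryDensity, abs_of_nonneg (Real.sqrt_nonneg _)]
    refine Real.sqrt_le_iff.2 ⟨hg.pos.le, ?_⟩
    nlinarith [sq_nonneg (g τ)]

/-- With weight `g²` the `α_j` need not be orthogonal. Adding the complementary weight produces the
constant `M²` and restores orthogonality. -/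
theorem IsEssBounded.integral_add_complementary (hg : IsEssBounded T g M) {a : ℝ → ℝ}
    (ha : MemLp a 2 (volume.restrict (Set.Icc 0 T))) :
    (∫ τ in Set.Icc 0 T, a τ ^ 2 * g τ ^ 2) +
      (∫ τ in Set.Icc 0 T, a τ ^ 2 * complementaryDensity g M τ ^ 2) =
      M ^ 2 * ∫ τ in Set.Icc 0 T, a τ ^ 2 := by
  rw [← integral_add (hg.integrable_sq_mul_sq ha) (hg.complementary.integrable_sq_mul_sq ha),
    ← integral_const_mul]
  refine integral_congr_ae ?_
  filter_upwards [hg.bound] with τ h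
  have h1 : g τ ^ 2 ≤ M ^ 2 := by
    rw [← sq_abs]
    gcongr
  simp only [complementaryDensity]
  rw [Real.sq_sqrt (by linarith)]
  ring

end GFFT

/-! ### Almost sure existence and law of the Paley–Wiener–Zygmund integral. -/

namespace GFFT

set_option linter.unusedSectionVars false

variable {T : ℝ} [hT : Fact (0 < T)] {g : ℝ → ℝ} {M : ℝ} {α : ℕ → ℝ → ℝ}

/-- A shortcut: the generic search for this instance on the path space is slow. -/
instance sFinite_of_isProbabilityMeasure (ν : Measure (C0 T)) [IsProbabilityMeasure ν] :
    SFinite ν :=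
  have : SigmaFinite ν := IsFiniteMeasure.toSigmaFinite ν
  instSFiniteOfSigmaFinite

/-- The quadratic form `∫_0^T u² g²`. -/
def energy (T : ℝ) (g : ℝ → ℝ) (u : ℝ → ℝ) : ℝ := ∫ τ in Set.Icc 0 T, u τ ^ 2 * g τ ^ 2

theorem energy_congr {u v : ℝ → ℝ} (h : u =ᵐ[volume.restrict (Set.Icc 0 T)] v) :
    energy T g u = energy T g v := by
  refine integral_congr_ae ?_
  filter_upwards [h] with τ hτ
  rw [hτ]

theorem energy_nonneg (u : ℝ → ℝ) : 0 ≤ energy T g u :=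
  integral_nonneg fun _ => mul_nonneg (sq_nonneg _) (sq_nonneg _)

theorem IsEssBounded.memLp_mul (hg : IsEssBounded T g M) {u : ℝ → ℝ}
    (hu : MemLp u 2 (volume.restrict (Set.Icc 0 T))) :
    MemLp (fun τ => g τ * u τ) 2 (volume.restrict (Set.Icc 0 T)) := by
  refine MemLp.of_le_mul (c := M) hu (hg.meas.mul hu.1) ?_
  filter_upwards [hg.bound] with τ h
  rw [norm_mul]
  exact mul_le_mul_of_nonneg_right h (norm_nonneg _)

theorem L2.norm_sq_eq (u : L2 T) : ‖u‖ ^ 2 = ∫ τ in Set.Icc 0 T, u τ ^ 2 := by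
  rw [← real_inner_self_eq_norm_sq, L2.inner_def]
  refine integral_congr_ae (Eventually.of_forall fun τ => ?_)
  simp [sq]

theorem energy_one (u : L2 T) : energy T (fun _ => 1) u = ‖u‖ ^ 2 := by
  rw [L2.norm_sq_eq]
  simp [energy]

/-- The energy is the squared norm of `g u`, and multiplication by `g` is `M`-Lipschitz on `L₂`. -/
theorem continuous_energy (hg : IsEssBounded T g M) :
    Continuous fun u : L2 T => energy T g u := by
  set m : L2 T → L2 T := fun u => (hg.memLp_mul (Lp.memLp u)).toLp _ with hm
  have hlip : LipschitzWith ⟨M, hg.pos.le⟩ m := by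
    refine LipschitzWith.of_dist_le_mul fun u v => ?_
    rw [dist_eq_norm, dist_eq_norm]
    refine Lp.norm_le_mul_norm_of_ae_le_mul ?_
    filter_upwards [hg.bound, Lp.coeFn_sub (m u) (m v), Lp.coeFn_sub u v,
      (hg.memLp_mul (Lp.memLp u)).coeFn_toLp, (hg.memLp_mul (Lp.memLp v)).coeFn_toLp]
      with τ h1 h2 h3 h4 h5
    rw [h2, h3, Pi.sub_apply, Pi.sub_apply, h4, h5, ← mul_sub, norm_mul]
    exact mul_le_mul_of_nonneg_right h1 (norm_nonneg _)
  have : (fun u : L2 T => energy T g u) = fun u => ‖m u‖ ^ 2 := by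
    ext u
    rw [L2.norm_sq_eq]
    refine integral_congr_ae ?_
    filter_upwards [(hg.memLp_mul (Lp.memLp u)).coeFn_toLp] with τ h
    rw [h]
    ring
  rw [this]
  exact (hlip.continuous.norm).pow 2

/-- The orthonormal sequence as a Hilbert basis of `L₂[0,T]`. -/
theorem IsCompleteOrthonormalBV.exists_hilbertBasis (hα : IsCompleteOrthonormalBV T α) :
    ∃ b : HilbertBasis ℕ ℝ (L2 T), ∀ j, b j =ᵐ[volume.restrict (Set.Icc 0 T)] α j := by
  set a : ℕ → L2 T := fun j => (BoundedVariationOn.memLp_two (hα.boundedVariation j)).toLp (α j)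
  have ha : ∀ j, a j =ᵐ[volume.restrict (Set.Icc 0 T)] α j := fun j => MemLp.coeFn_toLp _
  have hinner : ∀ (j : ℕ) (u : L2 T), inner ℝ (a j) u = ∫ τ in Set.Icc 0 T, u τ * α j τ := by
    intro j u
    rw [L2.inner_def]
    refine integral_congr_ae ?_
    filter_upwards [ha j] with τ h
    simp [h]
  have hon : Orthonormal ℝ a := by
    rw [orthonormal_iff_ite]
    intro i j
    rw [hinner, ← hα.orthonormal i j]
    refine integral_congr_ae ?_
    filter_upwards [ha j] with τ h
    rw [h, mul_comm]
  refine ⟨HilbertBasis.mkOfOrthogonalEqBot hon ?_, fun j => ?_⟩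
  · rw [Submodule.eq_bot_iff]
    intro u hu
    refine hα.complete u fun n => ?_
    rw [← hinner]
    exact (Submodule.mem_orthogonal _ _).1 hu _ (Submodule.subset_span ⟨n, rfl⟩)
  · rw [HilbertBasis.coe_mkOfOrthogonalEqBot]
    exact ha j

theorem HilbertBasis.repr_eq_integral (b : HilbertBasis ℕ ℝ (L2 T))
    (hb : ∀ j, b j =ᵐ[volume.restrict (Set.Icc 0 T)] α j) {u : ℝ → ℝ}
    (hu : MemLp u 2 (volume.restrict (Set.Icc 0 T))) (j : ℕ) :
    b.repr (hu.toLp u) j = ∫ τ in Set.Icc 0 T, u τ * α j τ := by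
  rw [b.repr_apply_apply, L2.inner_def]
  refine integral_congr_ae ?_
  filter_upwards [hb j, hu.coeFn_toLp] with τ h h'
  simp [h, h']

theorem IsCompleteOrthonormalBV.summable_sq (hα : IsCompleteOrthonormalBV T α) {u : ℝ → ℝ}
    (hu : MemLp u 2 (volume.restrict (Set.Icc 0 T))) :
    Summable fun j => (∫ τ in Set.Icc 0 T, u τ * α j τ) ^ 2 := by
  obtain ⟨b, hb⟩ := hα.exists_hilbertBasis
  have := lp.memℓp (b.repr (hu.toLp u))
  rw [memℓp_gen_iff (by norm_num)] at this
  simpa [HilbertBasis.repr_eq_integral b hb hu] using this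

theorem IsCompleteOrthonormalBV.tendsto_energy (hα : IsCompleteOrthonormalBV T α)
    (hg : IsEssBounded T g M) {u : ℝ → ℝ} (hu : MemLp u 2 (volume.restrict (Set.Icc 0 T))) :
    Tendsto (fun n => energy T g fun τ =>
      ∑ j ∈ Finset.range n, (∫ τ in Set.Icc 0 T, u τ * α j τ) * α j τ) atTop
      (𝓝 (energy T g u)) := by
  obtain ⟨b, hb⟩ := hα.exists_hilbertBasis
  have h1 := ((b.hasSum_repr (hu.toLp u)).tendsto_sum_nat)
  have h2 := ((continuous_energy hg).tendsto (hu.toLp u)).comp h1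
  rw [energy_congr hu.coeFn_toLp] at h2
  refine h2.congr fun n => ?_
  refine energy_congr ?_
  have h3 : ∀ S : Finset ℕ, (∑ j ∈ S, b.repr (hu.toLp u) j • b j : L2 T)
      =ᵐ[volume.restrict (Set.Icc 0 T)]
      fun τ => ∑ j ∈ S, (∫ τ in Set.Icc 0 T, u τ * α j τ) * α j τ := by
    intro S
    refine (Lp.coeFn_finsetSum S _).trans ?_
    have h4 : ∀ᵐ τ ∂(volume.restrict (Set.Icc 0 T)), ∀ j,
        (b.repr (hu.toLp u) j • b j : L2 T) τ =
          (∫ τ in Set.Icc 0 T, u τ * α j τ) * α j τ := by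
      refine ae_all_iff.2 fun j => ?_
      filter_upwards [hb j, Lp.coeFn_smul (b.repr (hu.toLp u) j) (b j)] with τ h h'
      rw [h', Pi.smul_apply, h, HilbertBasis.repr_eq_integral b hb hu, smul_eq_mul]
    filter_upwards [h4] with τ h
    simp [h]
  exact h3 _

theorem pwzSum_eq (u : ℝ → ℝ) (x : C0 T) : pwzSum α u x = fun n =>
    ∑ j ∈ Finset.range n, (∫ t in Set.Icc 0 T, u t * α j t) * stieltjes (α j) x := rfl

/-- The sign `e = ±1` disappears in the square, so both the sum and the difference of the two
independent processes turn the `α_j` into independent Gaussian variables of variance `M²`. -/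
theorem HasVarianceDensity.integral_exp_pm {ν ν' : Measure (C0 T)} [IsProbabilityMeasure ν]
    [IsProbabilityMeasure ν'] (hν : HasVarianceDensity ν g) (hg : IsEssBounded T g M)
    (hν' : HasVarianceDensity ν' (complementaryDensity g M)) (hα : IsCompleteOrthonormalBV T α)
    {e : ℝ} (he : e ^ 2 = 1) (S : Finset ℕ) (s : ℕ → ℝ) :
    ∫ z, Complex.exp (Complex.I *
      (∑ j ∈ S, s j * (stieltjes (α j) z.1 + e * stieltjes (α j) z.2) : ℝ)) ∂(ν.prod ν') =
      (Real.exp (-(M ^ 2 * ∑ j ∈ S, s j ^ 2) / 2) : ℂ) := by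
  have h1 : ∀ z : C0 T × C0 T, Complex.exp (Complex.I *
      (∑ j ∈ S, s j * (stieltjes (α j) z.1 + e * stieltjes (α j) z.2) : ℝ)) =
      Complex.exp (Complex.I * (∑ j ∈ S, s j * stieltjes (α j) z.1 : ℝ)) *
      Complex.exp (Complex.I * (∑ j ∈ S, (s j * e) * stieltjes (α j) z.2 : ℝ)) := by
    intro z
    rw [← Complex.exp_add, ← mul_add, ← Complex.ofReal_add, ← Finset.sum_add_distrib]
    congr 3
    exact Finset.sum_congr rfl fun j _ => by ring
  simp_rw [h1]
  have hprod := integral_prod_mul (μ := ν) (ν := ν') (fun z : C0 T =>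
      Complex.exp (Complex.I * (∑ j ∈ S, s j * stieltjes (α j) z : ℝ)))
    (fun z : C0 T => Complex.exp (Complex.I * (∑ j ∈ S, (s j * e) * stieltjes (α j) z : ℝ)))
  rw [hprod, hν.integral_exp_sum_stieltjes hg hα, hν'.integral_exp_sum_stieltjes hg.complementary hα,
    ← Complex.ofReal_mul, ← Real.exp_add]
  have h2 : ∀ τ, (∑ j ∈ S, s j * e * α j τ) ^ 2 = (∑ j ∈ S, s j * α j τ) ^ 2 := by
    intro τ
    have : ∑ j ∈ S, s j * e * α j τ = e * ∑ j ∈ S, s j * α j τ := by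
      rw [Finset.mul_sum]
      exact Finset.sum_congr rfl fun j _ => by ring
    rw [this, mul_pow, he, one_mul]
  simp_rw [h2]
  have h3 := hg.integral_add_complementary (hα.memLp_sum S s)
  rw [hα.integral_sq_sum] at h3
  rw [← h3]
  congr 2
  ring

/-- The Paley–Wiener–Zygmund integral exists almost surely for the law of a process
`∫_0^t g dW` with bounded `g`: adding and subtracting an independent process with the
complementary density gives series of independent Gaussian variables. -/
theorem HasVarianceDensity.ae_exists_hasPWZ {𝔪 ν : Measure (C0 T)} [IsProbabilityMeasure ν]
    (h𝔪 : IsWienerMeasure 𝔪) (hν : HasVarianceDensity ν g) (hg : IsEssBounded T g M)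
    (hα : IsCompleteOrthonormalBV T α) {u : ℝ → ℝ}
    (hu : MemLp u 2 (volume.restrict (Set.Icc 0 T))) :
    ∀ᵐ x ∂ν, ∃ l, HasPWZ α u x l := by
  have := h𝔪.isProbabilityMeasure
  have hν' := hasVarianceDensity_map_timeChange h𝔪 hg.complementary
  set ν' := 𝔪.map (timeChange hg.complementary)
  have : IsProbabilityMeasure ν' :=
    Measure.isProbabilityMeasure_map (measurable_timeChange _).aemeasurable
  have key : ∀ e : ℝ, e ^ 2 = 1 → ∀ᵐ z ∂(ν.prod ν'), ∃ l, Tendsto (fun n =>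
      ∑ j ∈ Finset.range n, (∫ t in Set.Icc 0 T, u t * α j t) *
        (stieltjes (α j) z.1 + e * stieltjes (α j) z.2)) atTop (𝓝 l) := by
    intro e he
    refine ae_exists_tendsto_sum (fun j => ?_) (hν.integral_exp_pm hg hν' hα he)
      (hα.summable_sq hu)
    exact ((measurable_stieltjes _).comp measurable_fst).add
      (((measurable_stieltjes _).comp measurable_snd).const_mul _)
  have h := Measure.ae_ae_of_ae_prod ((key 1 (by norm_num)).and (key (-1) (by norm_num)))
  filter_upwards [h] with x hx
  -- For almost every `x`, a single `z` at which both series converge is enough: their average is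
  -- the series at `x` alone.
  obtain ⟨z, ⟨l, hl⟩, ⟨l', hl'⟩⟩ := hx.exists
  refine ⟨(l + l') / 2, ?_⟩
  refine ((hl.add hl').div_const 2).congr fun n => ?_
  rw [pwzSum_eq, ← Finset.sum_add_distrib, Finset.sum_div]
  exact Finset.sum_congr rfl fun j _ => by ring

theorem HasPWZ.pwz_eq {u : ℝ → ℝ} {x : C0 T} {l : ℝ} (h : HasPWZ α u x l) : pwz α u x = l :=
  h.limUnder_eq

theorem hasPWZ_pwz {u : ℝ → ℝ} {x : C0 T} (h : ∃ l, HasPWZ α u x l) :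
    HasPWZ α u x (pwz α u x) :=
  tendsto_nhds_limUnder h

theorem measurable_pwzSum (u : ℝ → ℝ) (n : ℕ) : Measurable fun x : C0 T => pwzSum α u x n :=
  Finset.measurable_sum _ fun _ _ => (measurable_stieltjes _).const_mul _

theorem measurable_pwz (u : ℝ → ℝ) : Measurable fun x : C0 T => pwz α u x :=
  (StronglyMeasurable.limUnder fun n => (measurable_pwzSum u n).stronglyMeasurable).measurable

theorem HasVarianceDensity.integral_exp_pwz {𝔪 ν : Measure (C0 T)} [IsProbabilityMeasure ν]
    (h𝔪 : IsWienerMeasure 𝔪) (hν : HasVarianceDensity ν g) (hg : IsEssBounded T g M)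
    (hα : IsCompleteOrthonormalBV T α) {u : ℝ → ℝ}
    (hu : MemLp u 2 (volume.restrict (Set.Icc 0 T))) :
    ∫ x, Complex.exp (Complex.I * (pwz α u x : ℝ)) ∂ν =
      (Real.exp (-(energy T g u) / 2) : ℂ) := by
  have h1 : Tendsto (fun n => ∫ x, Complex.exp (Complex.I * (pwzSum α u x n : ℝ)) ∂ν) atTop
      (𝓝 (∫ x, Complex.exp (Complex.I * (pwz α u x : ℝ)) ∂ν)) := by
    refine tendsto_integral_of_dominated_convergence (fun _ => 1) (fun n => ?_)
      (integrable_const _) (fun n => Eventually.of_forall fun x => ?_) ?_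
    · have := measurable_pwzSum (T := T) (α := α) u n
      fun_prop
    · rw [norm_exp_I_mul_ofReal]
    · filter_upwards [hν.ae_exists_hasPWZ h𝔪 hg hα hu] with x hx
      refine (Complex.continuous_exp.tendsto _).comp (Tendsto.const_mul _ ?_)
      exact (Complex.continuous_ofReal.tendsto _).comp (hasPWZ_pwz hx)
  refine tendsto_nhds_unique h1 ?_
  simp_rw [pwzSum_eq, hν.integral_exp_sum_stieltjes hg hα]
  refine (Complex.continuous_ofReal.tendsto _).comp ((Real.continuous_exp.tendsto _).comp ?_)
  exact ((hα.tendsto_energy hg hu).neg).div_const 2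

end GFFT

/-! ### The process `𝒵_h`: continuous version and law. -/

namespace GFFT

set_option linter.unusedSectionVars false

variable {T : ℝ} [hT : Fact (0 < T)] {g : ℝ → ℝ} {M : ℝ} {α : ℕ → ℝ → ℝ}

theorem pwzSum_linear_combination (hα : IsCompleteOrthonormalBV T α) {ι : Type*} (S : Finset ι)
    (s : ι → ℝ) {u : ι → ℝ → ℝ} (hu : ∀ i, MemLp (u i) 2 (volume.restrict (Set.Icc 0 T)))
    (x : C0 T) (n : ℕ) :
    pwzSum α (fun τ => ∑ i ∈ S, s i * u i τ) x n = ∑ i ∈ S, s i * pwzSum α (u i) x n := by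
  have h1 : ∀ j, ∫ t in Set.Icc 0 T, (∑ i ∈ S, s i * u i t) * α j t =
      ∑ i ∈ S, s i * ∫ t in Set.Icc 0 T, u i t * α j t := by
    intro j
    have h2 : ∀ i ∈ S, Integrable (fun t => s i * (u i t * α j t))
        (volume.restrict (Set.Icc 0 T)) := fun i _ => ((hu i).integrable_mul
      (BoundedVariationOn.memLp_two (hα.boundedVariation j))).const_mul (s i)
    simp_rw [Finset.sum_mul, mul_assoc]
    rw [integral_finsetSum _ h2]
    simp_rw [← integral_const_mul]
  simp only [pwzSum]
  simp_rw [h1]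
  simp only [Finset.mul_sum, Finset.sum_mul]
  rw [Finset.sum_comm]
  exact Finset.sum_congr rfl fun i _ => Finset.sum_congr rfl fun k _ => by ring

theorem HasPWZ.linear_combination (hα : IsCompleteOrthonormalBV T α) {ι : Type*} (S : Finset ι)
    (s : ι → ℝ) {u : ι → ℝ → ℝ} (hu : ∀ i, MemLp (u i) 2 (volume.restrict (Set.Icc 0 T)))
    {x : C0 T} {l : ι → ℝ} (h : ∀ i, HasPWZ α (u i) x (l i)) :
    HasPWZ α (fun τ => ∑ i ∈ S, s i * u i τ) x (∑ i ∈ S, s i * l i) := by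
  unfold HasPWZ
  rw [show pwzSum α (fun τ => ∑ i ∈ S, s i * u i τ) x = _ from
    funext (pwzSum_linear_combination hα S s hu x)]
  exact tendsto_finsetSum _ fun i _ => (h i).const_mul _

theorem IsEssBounded.memLp_two (hg : IsEssBounded T g M) :
    MemLp g 2 (volume.restrict (Set.Icc 0 T)) :=
  MemLp.of_bound hg.meas M hg.bound

/-- The finite-dimensional laws of the process `∫_0^t g d̃x`. -/
theorem integral_exp_sum_pwz_indicator {𝔪 : Measure (C0 T)} (h𝔪 : IsWienerMeasure 𝔪)
    (hα : IsCompleteOrthonormalBV T α) (hg : IsEssBounded T g M) {ι : Type} [Fintype ι]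
    (s t : ι → ℝ) :
    ∫ x, Complex.exp (Complex.I *
      (∑ i, s i * pwz α ((Set.Icc 0 (t i)).indicator g) x : ℝ)) ∂𝔪 =
      (Real.exp (-(∫ τ in Set.Icc 0 T,
        (∑ i, s i * (Set.Icc 0 (t i)).indicator (fun _ => (1 : ℝ)) τ) ^ 2 * g τ ^ 2) / 2) : ℂ) := by
  have := h𝔪.isProbabilityMeasure
  have hu : ∀ i, MemLp ((Set.Icc 0 (t i)).indicator g) 2 (volume.restrict (Set.Icc 0 T)) :=
    fun i => hg.memLp_two.indicator measurableSet_Icc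
  have hu' : MemLp (fun τ => ∑ i, s i * (Set.Icc 0 (t i)).indicator g τ) 2
      (volume.restrict (Set.Icc 0 T)) := memLp_finsetSum _ fun i _ => (hu i).const_mul (s i)
  have h1 := h𝔪.hasVarianceDensity.integral_exp_pwz h𝔪 isEssBounded_one hα hu'
  have h2 : energy T (fun _ => 1) (fun τ => ∑ i, s i * (Set.Icc 0 (t i)).indicator g τ) =
      ∫ τ in Set.Icc 0 T,
        (∑ i, s i * (Set.Icc 0 (t i)).indicator (fun _ => (1 : ℝ)) τ) ^ 2 * g τ ^ 2 := by
    refine integral_congr_ae (Eventually.of_forall fun τ => ?_)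
    simp only [one_pow, mul_one]
    rw [← mul_pow, Finset.sum_mul]
    congr 1
    refine Finset.sum_congr rfl fun i _ => ?_
    by_cases h : τ ∈ Set.Icc 0 (t i) <;> simp [h]
  rw [h2] at h1
  rw [← h1]
  refine integral_congr_ae ?_
  have h3 : ∀ᵐ x ∂𝔪, ∀ i, ∃ l, HasPWZ α ((Set.Icc 0 (t i)).indicator g) x l :=
    ae_all_iff.2 fun i => h𝔪.hasVarianceDensity.ae_exists_hasPWZ h𝔪 isEssBounded_one hα (hu i)
  filter_upwards [h3] with x hx
  rw [(HasPWZ.linear_combination hα Finset.univ s hu fun i => hasPWZ_pwz (hx i)).pwz_eq]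

/-- The rational times in `[0,T]`. -/
abbrev RatTime (T : ℝ) : Type := {r : ℚ // (r : ℝ) ∈ Set.Icc (0 : ℝ) T}

/-- Characteristic functions determine the finite-dimensional marginals, and a projective limit of
finite measures is unique. -/
theorem measure_pi_ext {R : Type} {μ ν : Measure (R → ℝ)} [IsProbabilityMeasure μ]
    [IsProbabilityMeasure ν]
    (h : ∀ (I : Finset R) (s : I → ℝ),
      ∫ f, Complex.exp (Complex.I * (∑ i, s i * f i : ℝ)) ∂μ =
        ∫ f, Complex.exp (Complex.I * (∑ i, s i * f i : ℝ)) ∂ν) : μ = ν := by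
  classical
  have hfin : ∀ (ρ : Measure (R → ℝ)) [IsProbabilityMeasure ρ] (I : Finset R),
      IsProbabilityMeasure (ρ.map I.restrict) := fun ρ _ I =>
    Measure.isProbabilityMeasure_map (Finset.measurable_restrict I).aemeasurable
  have hp : ∀ I : Finset R, IsFiniteMeasure (ν.map I.restrict) := fun I => by
    have := hfin ν I
    infer_instance
  refine IsProjectiveLimit.unique (P := fun I : Finset R => ν.map I.restrict) (fun I => ?_)
    (fun I => rfl)
  have h1 := hfin μ I
  have h2 := hfin ν I
  refine Measure.ext_of_charFunDual (funext fun L => ?_)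
  have hL : ∀ f : R → ℝ, L (I.restrict f) = ∑ i : I, L (Pi.single i 1) * f i := by
    intro f
    have := LinearMap.pi_apply_eq_sum_univ (L : (I → ℝ) →ₗ[ℝ] ℝ) (I.restrict f)
    refine this.trans (Finset.sum_congr rfl fun i _ => ?_)
    rw [smul_eq_mul, mul_comm]
    have hsingle : (Pi.single i 1 : I → ℝ) = fun j => if i = j then 1 else 0 := by
      ext j
      simp [Pi.single_apply, eq_comm]
    rw [hsingle]
    rfl
  rw [charFunDual_apply, charFunDual_apply,
    integral_map (Finset.measurable_restrict I).aemeasurable (by fun_prop),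
    integral_map (Finset.measurable_restrict I).aemeasurable (by fun_prop)]
  simp_rw [hL, mul_comm _ Complex.I]
  exact h I _

/-- Uniform continuity on the rational times, with a countable description, and vanishing at
the time `0`. -/
def ratUniformlyContinuous (T : ℝ) : Set (RatTime T → ℝ) :=
  {f | (∀ n : ℕ, ∃ m : ℕ, ∀ r s : RatTime T, |((r.1 : ℝ) - s.1)| < 1 / ((m : ℝ) + 1) →
    |f r - f s| ≤ 1 / ((n : ℝ) + 1)) ∧ ∀ r : RatTime T, r.1 = 0 → f r = 0}

theorem measurableSet_ratUniformlyContinuous :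
    MeasurableSet (ratUniformlyContinuous T) := by
  unfold ratUniformlyContinuous
  refine MeasurableSet.inter (s₁ := {f : RatTime T → ℝ | ∀ n : ℕ, ∃ m : ℕ, ∀ r s : RatTime T,
    |((r.1 : ℝ) - s.1)| < 1 / ((m : ℝ) + 1) → |f r - f s| ≤ 1 / ((n : ℝ) + 1)})
    (s₂ := {f : RatTime T → ℝ | ∀ r : RatTime T, r.1 = 0 → f r = 0}) ?_ ?_
  · rw [Set.ofPred_forall]
    refine MeasurableSet.iInter fun n => ?_
    rw [Set.ofPred_exists]
    refine MeasurableSet.iUnion fun m => ?_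
    rw [Set.ofPred_forall]
    refine MeasurableSet.iInter fun r => ?_
    rw [Set.ofPred_forall]
    refine MeasurableSet.iInter fun s => ?_
    by_cases h : |((r.1 : ℝ) - s.1)| < 1 / ((m : ℝ) + 1)
    · simp only [h, forall_true_left]
      exact measurableSet_le ((measurable_pi_apply r).sub (measurable_pi_apply s)).abs
        measurable_const
    · simp only [h, IsEmpty.forall_iff, Set.ofPred_true, MeasurableSet.univ]
  · rw [Set.ofPred_forall]
    refine MeasurableSet.iInter fun r => ?_
    by_cases h : r.1 = 0
    · simp only [h, forall_true_left]
      exact measurableSet_eq_fun (measurable_pi_apply r) measurable_const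
    · simp [h]

theorem value_mem_ratUniformlyContinuous (x : C0 T) :
    (fun r : RatTime T => value x r.1) ∈ ratUniformlyContinuous T := by
  refine ⟨fun n => ?_, fun r hr => ?_⟩
  · obtain ⟨δ, hδ, hd⟩ := Metric.uniformContinuous_iff.1 (uniformContinuous_value x)
      (1 / ((n : ℝ) + 1)) (by positivity)
    obtain ⟨m, hm⟩ := exists_nat_one_div_lt hδ
    refine ⟨m, fun r s hrs => ?_⟩
    have := hd (a := (r.1 : ℝ)) (b := s.1) (by rw [Real.dist_eq]; exact hrs.trans hm)
    rw [Real.dist_eq] at this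
    exact this.le
  · have := x.2
    simp only [hr, value, Rat.cast_zero, Set.projIcc_left]
    exact this

/-- Extension by uniform continuity from the dense set of rational times. -/
theorem exists_path_of_ratUniformlyContinuous {f : RatTime T → ℝ}
    (hf : f ∈ ratUniformlyContinuous T) :
    ∃ z : C0 T, ∀ r : RatTime T, value z r.1 = f r := by
  set e : RatTime T → Set.Icc (0 : ℝ) T := fun r => ⟨(r.1 : ℝ), r.2⟩ with he
  have hiso : Isometry e := Isometry.of_dist_eq fun r s => rfl
  have hdense : DenseRange e := by
    intro t
    rw [closure_subtype]
    refine closure_mono ?_ (Icc_subset_closure_rat t.2)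
    rintro s ⟨hs, r, rfl⟩
    exact ⟨⟨r, hs⟩, ⟨⟨r, hs⟩, rfl⟩, rfl⟩
  have hfu : UniformContinuous f := by
    refine Metric.uniformContinuous_iff.2 fun ε hε => ?_
    obtain ⟨n, hn⟩ := exists_nat_one_div_lt hε
    obtain ⟨m, hm⟩ := hf.1 n
    refine ⟨1 / ((m : ℝ) + 1), by positivity, fun r s hrs => ?_⟩
    rw [Real.dist_eq]
    exact (hm r s hrs).trans_lt hn
  have hind := hiso.isUniformInducing
  set ψ : Set.Icc (0 : ℝ) T → ℝ := (hind.isDenseInducing hdense).extend f with hψ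
  have hψc : Continuous ψ := (uniformContinuous_uniformly_extend hind hdense hfu).continuous
  have hψe : ∀ r, ψ (e r) = f r := fun r => uniformly_extend_of_ind hind hdense hfu r
  refine ⟨⟨⟨ψ, hψc⟩, ?_⟩, fun r => ?_⟩
  · have h0 := hψe ⟨0, by simp [hT.out.le]⟩
    rw [hf.2 _ rfl] at h0
    change ψ _ = 0
    refine Eq.trans (congrArg ψ (Subtype.ext ?_)) h0
    simp [he]
  · rw [← hψe r]
    change ψ _ = ψ _
    rw [Set.projIcc_of_mem _ r.2]

/-- On rational times the integrals `⟨1_[0,r] g, x⟩` have the same joint law as the time-changed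
Wiener path. The latter is always uniformly continuous; as this is a measurable event for countably
many coordinates, the former is so almost surely. -/
theorem ae_exists_isGaussianPath {𝔪 : Measure (C0 T)} (h𝔪 : IsWienerMeasure 𝔪)
    (hα : IsCompleteOrthonormalBV T α) (hg : IsEssBounded T g M) :
    ∀ᵐ x ∂𝔪, ∃ z, IsGaussianPath α g x z := by
  have := h𝔪.isProbabilityMeasure
  set A : C0 T → RatTime T → ℝ := fun x r => pwz α ((Set.Icc 0 (r.1 : ℝ)).indicator g) x
  set B : C0 T → RatTime T → ℝ := fun x r => value (timeChange hg x) r.1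
  have hA : Measurable A := measurable_pi_lambda _ fun r => measurable_pwz _
  have hB : Measurable B := measurable_pi_lambda _ fun r =>
    (continuous_value_left _).measurable.comp (measurable_timeChange hg)
  have hpA : IsProbabilityMeasure (𝔪.map A) := Measure.isProbabilityMeasure_map hA.aemeasurable
  have hpB : IsProbabilityMeasure (𝔪.map B) := Measure.isProbabilityMeasure_map hB.aemeasurable
  have hAB : 𝔪.map A = 𝔪.map B := by
    refine measure_pi_ext fun I s => ?_
    have hc : Continuous fun f : RatTime T → ℝ =>
        Complex.exp (Complex.I * (∑ i : I, s i * f i : ℝ)) := by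
      have : Continuous fun f : RatTime T → ℝ => ∑ i : I, s i * f i :=
        continuous_finsetSum _ fun i _ => (continuous_apply _).const_mul _
      fun_prop
    rw [integral_map hA.aemeasurable hc.measurable.aestronglyMeasurable,
      integral_map hB.aemeasurable hc.measurable.aestronglyMeasurable]
    have h1 := integral_exp_sum_pwz_indicator h𝔪 hα hg s (fun i : I => ((i.1.1 : ℚ) : ℝ))
    have h2 := hasVarianceDensity_map_timeChange h𝔪 hg I s (fun i : I => ((i.1.1 : ℚ) : ℝ))
      fun i => i.1.2
    rw [integral_map (measurable_timeChange hg).aemeasurable] at h2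
    · exact h1.trans h2.symm
    · refine Continuous.aestronglyMeasurable ?_
      have : Continuous fun x : C0 T => ∑ i : I, s i * value x ((i.1.1 : ℚ) : ℝ) :=
        continuous_finsetSum _ fun i _ => (continuous_value_left _).const_mul _
      fun_prop
  have hU : ∀ᵐ x ∂𝔪, A x ∈ ratUniformlyContinuous T := by
    have h1 : ∀ᵐ f ∂(𝔪.map B), f ∈ ratUniformlyContinuous T :=
      (ae_map_iff hB.aemeasurable measurableSet_ratUniformlyContinuous).2
        (Eventually.of_forall fun x => value_mem_ratUniformlyContinuous _)
    rw [← hAB] at h1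
    exact (ae_map_iff hA.aemeasurable measurableSet_ratUniformlyContinuous).1 h1
  have hP : ∀ᵐ x ∂𝔪, ∀ r : RatTime T, ∃ l, HasPWZ α ((Set.Icc 0 (r.1 : ℝ)).indicator g) x l :=
    ae_all_iff.2 fun r => h𝔪.hasVarianceDensity.ae_exists_hasPWZ h𝔪 isEssBounded_one hα
      (hg.memLp_two.indicator measurableSet_Icc)
  filter_upwards [hU, hP] with x h1 h2
  obtain ⟨z, hz⟩ := exists_path_of_ratUniformlyContinuous h1
  refine ⟨z, fun r hr => ?_⟩
  have := hasPWZ_pwz (h2 ⟨r, hr⟩)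
  rwa [hz ⟨r, hr⟩]

theorem isGaussianPath_gaussianPath {x : C0 T} (h : ∃ z, IsGaussianPath α g x z) :
    IsGaussianPath α g x (gaussianPath α g x) := by
  rw [gaussianPath, dif_pos h]
  exact h.choose_spec

theorem aemeasurable_gaussianPath {𝔪 : Measure (C0 T)} (h𝔪 : IsWienerMeasure 𝔪)
    (hα : IsCompleteOrthonormalBV T α) (hg : IsEssBounded T g M) :
    AEMeasurable (gaussianPath α g) 𝔪 := by
  classical
  have hae := ae_exists_isGaussianPath h𝔪 hα hg
  -- The set of paths without a continuous version is not known to be measurable, so the process is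
  -- modified on a measurable null set containing it.
  obtain ⟨N, hN, hNm, hN0⟩ := exists_measurable_superset_of_null (ae_iff.1 hae)
  refine ⟨fun x => if x ∈ N then 0 else gaussianPath α g x, ?_, ?_⟩
  · refine measurable_of_value fun r hr => ?_
    have : (fun x : C0 T => value (if x ∈ N then 0 else gaussianPath α g x) r) =
        fun x => if x ∈ N then 0 else pwz α ((Set.Icc 0 (r : ℝ)).indicator g) x := by
      ext x
      by_cases hx : x ∈ N
      · simp [hx]
      · have hx' : ∃ z, IsGaussianPath α g x z := by
          by_contra hcon
          exact hx (hN hcon)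
        simp only [hx, if_false]
        exact (isGaussianPath_gaussianPath hx' r hr).pwz_eq.symm
    rw [this]
    exact Measurable.ite hNm measurable_const (measurable_pwz _)
  · have : ∀ᵐ x ∂𝔪, x ∉ N := measure_eq_zero_iff_ae_notMem.1 hN0
    filter_upwards [this] with x hx
    simp [hx]

theorem exists_rat_seq {t : ℝ} (ht : t ∈ Set.Icc 0 T) :
    ∃ r : ℕ → ℚ, (∀ n, (r n : ℝ) ∈ Set.Icc 0 T) ∧ Tendsto (fun n => (r n : ℝ)) atTop (𝓝 t) := by
  obtain ⟨y, hy, hyt⟩ := mem_closure_iff_seq_limit.1 (Icc_subset_closure_rat ht)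
  choose h1 r hr using hy
  refine ⟨r, fun n => by rw [hr]; exact h1 n, ?_⟩
  simpa [hr] using hyt

/-- The formula is known at rational times; continuity of the paths and of the clock extends it to
all times. -/
theorem hasVarianceDensity_map_gaussianPath {𝔪 : Measure (C0 T)} (h𝔪 : IsWienerMeasure 𝔪)
    (hα : IsCompleteOrthonormalBV T α) (hg : IsEssBounded T g M) :
    HasVarianceDensity (𝔪.map (gaussianPath α g)) g := by
  intro ι _ s t ht
  have := h𝔪.isProbabilityMeasure
  have hcont : ∀ t : ι → ℝ, Continuous fun x : C0 T => ∑ i, s i * value x (t i) := fun t =>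
    continuous_finsetSum _ fun i _ => (continuous_value_left _).const_mul _
  have hZ := aemeasurable_gaussianPath h𝔪 hα hg
  choose r hr hrt using fun i => exists_rat_seq (ht i)
  rw [integral_map hZ (by have := hcont t; exact Continuous.aestronglyMeasurable (by fun_prop)),
    integral_sq_sum_indicator hg]
  have h1 : ∀ n, ∫ x, Complex.exp (Complex.I *
      (∑ i, s i * value (gaussianPath α g x) (r i n) : ℝ)) ∂𝔪 =
      (Real.exp (-(∑ i, ∑ j, s i * s j * varianceClock T g (min (r i n : ℝ) (r j n))) / 2) : ℂ) := by
    intro n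
    rw [← integral_sq_sum_indicator hg s fun i => (r i n : ℝ),
      ← integral_exp_sum_pwz_indicator h𝔪 hα hg s fun i => (r i n : ℝ)]
    refine integral_congr_ae ?_
    filter_upwards [ae_exists_isGaussianPath h𝔪 hα hg] with x hx
    have : ∀ i, value (gaussianPath α g x) (r i n) =
        pwz α ((Set.Icc 0 (r i n : ℝ)).indicator g) x := fun i =>
      (isGaussianPath_gaussianPath hx (r i n) (hr i n)).pwz_eq.symm
    simp_rw [this]
  have h2 : Tendsto (fun n => ∫ x, Complex.exp (Complex.I *
      (∑ i, s i * value (gaussianPath α g x) (r i n) : ℝ)) ∂𝔪) atTop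
      (𝓝 (∫ x, Complex.exp (Complex.I *
        (∑ i, s i * value (gaussianPath α g x) (t i) : ℝ)) ∂𝔪)) := by
    refine tendsto_integral_of_dominated_convergence (fun _ => 1) (fun n => ?_)
      (integrable_const _) (fun n => Eventually.of_forall fun x => ?_)
      (Eventually.of_forall fun x => ?_)
    · have h3 := (hcont fun i => (r i n : ℝ)).measurable.comp_aemeasurable hZ
      have h4 : Measurable fun y : ℝ => Complex.exp (Complex.I * (y : ℂ)) := by fun_prop
      exact (h4.comp_aemeasurable h3).aestronglyMeasurable
    · rw [norm_exp_I_mul_ofReal]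
    · refine (Complex.continuous_exp.tendsto _).comp (Tendsto.const_mul _ ?_)
      refine (Complex.continuous_ofReal.tendsto _).comp ?_
      exact tendsto_finsetSum _ fun i _ =>
        (((uniformContinuous_value _).continuous.tendsto _).comp (hrt i)).const_mul _
  refine tendsto_nhds_unique h2 ?_
  simp_rw [h1]
  refine (Complex.continuous_ofReal.tendsto _).comp ((Real.continuous_exp.tendsto _).comp ?_)
  refine Tendsto.div_const (Tendsto.neg ?_) 2
  exact tendsto_finsetSum _ fun i _ => tendsto_finsetSum _ fun j _ =>
    (((continuous_varianceClock hg).tendsto _).comp ((hrt i).min (hrt j))).const_mul _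

end GFFT

/-! ### Functionals represented by a density, and Fubini. -/

namespace GFFT

set_option linter.unusedSectionVars false

variable {T : ℝ} [hT : Fact (0 < T)] {g : ℝ → ℝ} {M : ℝ} {α : ℕ → ℝ → ℝ}

theorem measurable_integral_mul (hα : IsCompleteOrthonormalBV T α) (j : ℕ) :
    Measurable fun u : L2 T => ∫ t in Set.Icc 0 T, u t * α j t := by
  obtain ⟨b, hb⟩ := hα.exists_hilbertBasis
  have : (fun u : L2 T => ∫ t in Set.Icc 0 T, u t * α j t) = fun u : L2 T => inner ℝ (b j) u := by
    ext u
    rw [L2.inner_def]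
    refine integral_congr_ae ?_
    filter_upwards [hb j] with τ h
    simp [h]
  rw [this]
  exact (continuous_const.inner continuous_id).measurable

theorem measurable_pwzSum_prod (hα : IsCompleteOrthonormalBV T α) (n : ℕ) :
    Measurable fun z : C0 T × L2 T => pwzSum α z.2 z.1 n :=
  Finset.measurable_sum _ fun j _ => ((measurable_integral_mul hα j).comp measurable_snd).mul
    ((measurable_stieltjes _).comp measurable_fst)

theorem measurable_pwz_prod (hα : IsCompleteOrthonormalBV T α) :
    Measurable fun z : C0 T × L2 T => pwz α z.2 z.1 :=
  (StronglyMeasurable.limUnder fun n => (measurable_pwzSum_prod hα n).stronglyMeasurable).measurable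

theorem measurable_pwz_left (hα : IsCompleteOrthonormalBV T α) (x : C0 T) :
    Measurable fun u : L2 T => pwz α u x :=
  (measurable_pwz_prod hα).comp (g := fun z : C0 T × L2 T => pwz α z.2 z.1)
    (f := fun u : L2 T => (x, u)) measurable_prodMk_left

theorem measurableSet_exists_hasPWZ (hα : IsCompleteOrthonormalBV T α) :
    MeasurableSet {z : C0 T × L2 T | ∃ l, HasPWZ α z.2 z.1 l} :=
  measurableSet_exists_tendsto fun n => measurable_pwzSum_prod hα n

theorem HasPWZ.add_smul (hα : IsCompleteOrthonormalBV T α) {u : ℝ → ℝ} {x y : C0 T} {l m : ℝ}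
    (hx : HasPWZ α u x l) (hy : HasPWZ α u y m) (c : ℝ) : HasPWZ α u (x + c • y) (l + c * m) := by
  refine (Tendsto.add hx (hy.const_mul c)).congr fun n => ?_
  simp only [pwzSum, stieltjes_add (hα.boundedVariation _), stieltjes_smul (hα.boundedVariation _)]
  rw [Finset.mul_sum, ← Finset.sum_add_distrib]
  exact Finset.sum_congr rfl fun j _ => by ring

theorem HasPWZ.smul (hα : IsCompleteOrthonormalBV T α) {u : ℝ → ℝ} {y : C0 T} {m : ℝ}
    (hy : HasPWZ α u y m) (c : ℝ) : HasPWZ α u (c • y) (c * m) := by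
  refine (hy.const_mul c).congr fun n => ?_
  simp only [pwzSum, stieltjes_smul (hα.boundedVariation _)]
  rw [Finset.mul_sum]
  exact Finset.sum_congr rfl fun j _ => by ring

/-- The Paley–Wiener–Zygmund integral at `x` exists for almost every integrand. -/
def IsGoodPath (α : ℕ → ℝ → ℝ) (μ : Measure (L2 T)) (x : C0 T) : Prop :=
  ∀ᵐ u : L2 T ∂μ, ∃ l, HasPWZ α u x l

theorem IsGoodPath.add_smul (hα : IsCompleteOrthonormalBV T α) {μ : Measure (L2 T)} {x y : C0 T}
    (hx : IsGoodPath α μ x) (hy : IsGoodPath α μ y) (c : ℝ) : IsGoodPath α μ (x + c • y) := by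
  filter_upwards [hx, hy] with u ⟨l, hl⟩ ⟨m, hm⟩
  exact ⟨_, hl.add_smul hα hm c⟩

theorem IsGoodPath.smul (hα : IsCompleteOrthonormalBV T α) {μ : Measure (L2 T)} {y : C0 T}
    (hy : IsGoodPath α μ y) (c : ℝ) : IsGoodPath α μ (c • y) := by
  filter_upwards [hy] with u ⟨m, hm⟩
  exact ⟨_, hm.smul hα c⟩

/-- For every `u` the integral exists at almost every path; joint measurability allows the two
quantifiers to be exchanged. -/
theorem HasVarianceDensity.ae_isGoodPath {𝔪 ν : Measure (C0 T)} [IsProbabilityMeasure ν]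
    (h𝔪 : IsWienerMeasure 𝔪) (hν : HasVarianceDensity ν g) (hg : IsEssBounded T g M)
    (hα : IsCompleteOrthonormalBV T α) (μ : Measure (L2 T)) [IsFiniteMeasure μ] :
    ∀ᵐ x ∂ν, IsGoodPath α μ x := by
  unfold IsGoodPath
  rw [Measure.ae_ae_comm (p := fun x (u : L2 T) => ∃ l, HasPWZ α u x l)
    (measurableSet_exists_hasPWZ hα)]
  exact Eventually.of_forall fun u => hν.ae_exists_hasPWZ h𝔪 hg hα (Lp.memLp u)

theorem IsWienerMeasure.sAE_isGoodPath {𝔪 : Measure (C0 T)} (h𝔪 : IsWienerMeasure 𝔪)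
    (hα : IsCompleteOrthonormalBV T α) (μ : Measure (L2 T)) [IsFiniteMeasure μ] :
    SAE 𝔪 (IsGoodPath α μ) := by
  have := h𝔪.isProbabilityMeasure
  intro ρ _
  filter_upwards [h𝔪.hasVarianceDensity.ae_isGoodPath h𝔪 isEssBounded_one hα μ] with x hx
  exact hx.smul hα ρ

/-- `F(x) = ∫ exp(i⟨u,x⟩) θ(u) dμ(u)` at every good path `x`. -/
def Represents (α : ℕ → ℝ → ℝ) (μ : Measure (L2 T)) (θ : L2 T → ℂ) (F : C0 T → ℂ) : Prop :=
  ∀ x, IsGoodPath α μ x → F x = ∫ u, Complex.exp (Complex.I * (pwz α u x : ℂ)) * θ u ∂μ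

/-- The variation of `θ μ` is dominated by `μ`, so a path good for `μ` is one where the defining
formula of the class applies. -/
theorem represents_of_isGivenBy (hα : IsCompleteOrthonormalBV T α) {μ : Measure (L2 T)}
    [IsFiniteMeasure μ] {θ : L2 T → ℂ} (hθm : Measurable θ) (hθ : Integrable θ μ) {F : C0 T → ℂ}
    (hF : IsGivenBy α (μ.withDensityᵥ θ) F) : Represents α μ θ F := by
  intro x hx
  have hvar := Measure.variation_withDensityᵥ hθ
  have hac : (μ.withDensityᵥ θ).variation ≪ μ := by
    rw [hvar]
    exact withDensity_absolutelyContinuous _ _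
  rw [hF x (hac.ae_le hx)]
  refine integral_withDensityᵥ hθ hθm ?_
  have : IsFiniteMeasure (μ.withDensity fun u => ‖θ u‖ₑ) := isFiniteMeasure_withDensity hθ.2.ne
  have hm := measurable_pwz_left hα x
  have hm' : Measurable fun u : L2 T => Complex.exp (Complex.I * (pwz α u x : ℂ)) := by fun_prop
  refine Integrable.of_bound (C := 1) hm'.aestronglyMeasurable (Eventually.of_forall fun u => ?_)
  rw [norm_exp_I_mul_ofReal]

theorem exists_represents_mem_classS (hα : IsCompleteOrthonormalBV T α) {μ : Measure (L2 T)}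
    [IsFiniteMeasure μ] {θ : L2 T → ℂ} (hθm : Measurable θ) (hθ : Integrable θ μ) :
    ∃ F ∈ (classS α : Set (C0 T → ℂ)), Represents α μ θ F := by
  have : IsGivenBy α (μ.withDensityᵥ θ) fun x : C0 T =>
      (μ.withDensityᵥ θ).integral (fun u : L2 T => Complex.exp (Complex.I * (pwz α u x : ℂ)))
        (ContinuousLinearMap.mul ℝ ℂ) := fun x _ => rfl
  exact ⟨_, ⟨_, this⟩, represents_of_isGivenBy hα hθm hθ this⟩

/-- The sum of the two variations dominates both measures; over this common base two functionals are
compared through their densities. -/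
theorem exists_represents_pair (hα : IsCompleteOrthonormalBV T α) {F G : C0 T → ℂ}
    (hF : F ∈ (classS α : Set (C0 T → ℂ))) (hG : G ∈ (classS α : Set (C0 T → ℂ))) :
    ∃ (μ : Measure (L2 T)) (_ : IsFiniteMeasure μ) (θ η : L2 T → ℂ), Measurable θ ∧
      Integrable θ μ ∧ Measurable η ∧ Integrable η μ ∧ Represents α μ θ F ∧ Represents α μ η G := by
  obtain ⟨f, hf⟩ := hF
  obtain ⟨k, hk⟩ := hG
  have h1 := ComplexMeasure.isFiniteMeasure_variation f
  have h2 := ComplexMeasure.isFiniteMeasure_variation k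
  obtain ⟨θ, hθm, hθ, hθf⟩ := ComplexMeasure.exists_withDensityᵥ_eq f (f.variation + k.variation)
    (Measure.AbsolutelyContinuous.rfl.add_right _)
  obtain ⟨η, hηm, hη, hηf⟩ := ComplexMeasure.exists_withDensityᵥ_eq k (f.variation + k.variation)
    (by rw [add_comm]; exact Measure.AbsolutelyContinuous.rfl.add_right _)
  refine ⟨f.variation + k.variation, inferInstance, θ, η, hθm, hθ, hηm, hη,
    represents_of_isGivenBy hα hθm hθ ?_, represents_of_isGivenBy hα hηm hη ?_⟩
  · rwa [hθf]
  · rwa [hηf]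

theorem HasVarianceDensity.integral_exp_mul_pwz {𝔪 ν : Measure (C0 T)} [IsProbabilityMeasure ν]
    (h𝔪 : IsWienerMeasure 𝔪) (hν : HasVarianceDensity ν g) (hg : IsEssBounded T g M)
    (hα : IsCompleteOrthonormalBV T α) {u : ℝ → ℝ}
    (hu : MemLp u 2 (volume.restrict (Set.Icc 0 T))) (c : ℝ) :
    ∫ x, Complex.exp (Complex.I * (c * pwz α u x : ℝ)) ∂ν =
      (Real.exp (-(c ^ 2 * energy T g u) / 2) : ℂ) := by
  have h1 := hν.integral_exp_pwz h𝔪 hg hα (hu.const_mul c)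
  have h2 : energy T g (fun τ => c * u τ) = c ^ 2 * energy T g u := by
    simp only [energy, ← integral_const_mul]
    exact integral_congr_ae (Eventually.of_forall fun τ => by ring)
  rw [h2] at h1
  rw [← h1]
  refine integral_congr_ae ?_
  filter_upwards [hν.ae_exists_hasPWZ h𝔪 hg hα hu] with x hx
  have := HasPWZ.linear_combination hα {()} (fun _ => c) (u := fun _ => u) (fun _ => hu)
    fun _ => hasPWZ_pwz hx
  simp only [Finset.sum_singleton] at this
  rw [this.pwz_eq]

section Fubini

variable {μ : Measure (L2 T)} [IsFiniteMeasure μ] {θ : L2 T → ℂ} {F : C0 T → ℂ} {y : C0 T}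
  {𝔪 ν : Measure (C0 T)} [IsProbabilityMeasure ν]

theorem Represents.ae_eq (hα : IsCompleteOrthonormalBV T α) (hF : Represents α μ θ F)
    (h𝔪 : IsWienerMeasure 𝔪) (hν : HasVarianceDensity ν g) (hg : IsEssBounded T g M)
    (hy : IsGoodPath α μ y) (c : ℝ) :
    (fun z => F (y + c • z)) =ᵐ[ν] fun z => ∫ u, Complex.exp (Complex.I * (c * pwz α u z : ℝ)) *
      (Complex.exp (Complex.I * (pwz α u y : ℝ)) * θ u) ∂μ := by
  filter_upwards [hν.ae_isGoodPath h𝔪 hg hα μ] with z hz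
  rw [hF _ (hy.add_smul hα hz c)]
  refine integral_congr_ae ?_
  filter_upwards [hy, hz] with u h1 h2
  rw [((hasPWZ_pwz h1).add_smul hα (hasPWZ_pwz h2) c).pwz_eq, ← mul_assoc, ← Complex.exp_add,
    ← mul_add, ← Complex.ofReal_add, add_comm]

theorem measurable_exp_pwz_mul (hα : IsCompleteOrthonormalBV T α) (hθm : Measurable θ)
    (y : C0 T) : Measurable fun u : L2 T => Complex.exp (Complex.I * (pwz α u y : ℝ)) * θ u := by
  have := measurable_pwz_left hα y
  fun_prop

theorem integrable_exp_pwz_mul (hα : IsCompleteOrthonormalBV T α) (hθm : Measurable θ)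
    (hθ : Integrable θ μ) (y : C0 T) :
    Integrable (fun u : L2 T => Complex.exp (Complex.I * (pwz α u y : ℝ)) * θ u) μ :=
  hθ.mono (measurable_exp_pwz_mul hα hθm y).aestronglyMeasurable
    (Eventually.of_forall fun u => by rw [norm_mul, norm_exp_I_mul_ofReal, one_mul])

theorem measurable_exp_pwz_prod_mul (hα : IsCompleteOrthonormalBV T α) (hθm : Measurable θ)
    (c : ℝ) : Measurable fun z : C0 T × L2 T =>
      Complex.exp (Complex.I * (c * pwz α z.2 z.1 : ℝ)) * θ z.2 := by
  have := measurable_pwz_prod hα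
  fun_prop

theorem integrable_exp_pwz_prod_mul (hα : IsCompleteOrthonormalBV T α) (hθm : Measurable θ)
    (hθ : Integrable θ μ) (c : ℝ) (ν : Measure (C0 T)) [IsProbabilityMeasure ν] :
    Integrable (fun z : C0 T × L2 T =>
      Complex.exp (Complex.I * (c * pwz α z.2 z.1 : ℝ)) * θ z.2) (ν.prod μ) :=
  (hθ.comp_snd ν).mono (measurable_exp_pwz_prod_mul hα hθm c).aestronglyMeasurable
    (Eventually.of_forall fun u => by rw [norm_mul, norm_exp_I_mul_ofReal, one_mul])

theorem Represents.integrable (hα : IsCompleteOrthonormalBV T α) (hF : Represents α μ θ F)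
    (hθm : Measurable θ) (hθ : Integrable θ μ)
    (h𝔪 : IsWienerMeasure 𝔪) (hν : HasVarianceDensity ν g) (hg : IsEssBounded T g M)
    (hy : IsGoodPath α μ y) (c : ℝ) : Integrable (fun z => F (y + c • z)) ν :=
  (integrable_exp_pwz_prod_mul hα (measurable_exp_pwz_mul hα hθm y)
    (integrable_exp_pwz_mul hα hθm hθ y) c ν).integral_prod_left.congr
    (hF.ae_eq hα h𝔪 hν hg hy c).symm

/-- Fubini and the Gaussian characteristic function. The main use is with `ν` the law of `𝒵_h` and
`c = λ^{-1/2}`. -/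
theorem Represents.integral_eq (hα : IsCompleteOrthonormalBV T α) (hF : Represents α μ θ F)
    (hθm : Measurable θ) (hθ : Integrable θ μ)
    (h𝔪 : IsWienerMeasure 𝔪) (hν : HasVarianceDensity ν g) (hg : IsEssBounded T g M)
    (hy : IsGoodPath α μ y) (c : ℝ) :
    ∫ z, F (y + c • z) ∂ν = ∫ u : L2 T, (Real.exp (-(c ^ 2 * energy T g u) / 2) : ℂ) *
      (Complex.exp (Complex.I * (pwz α u y : ℝ)) * θ u) ∂μ := by
  rw [integral_congr_ae (hF.ae_eq hα h𝔪 hν hg hy c),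
    integral_integral_swap (integrable_exp_pwz_prod_mul hα (measurable_exp_pwz_mul hα hθm y)
      (integrable_exp_pwz_mul hα hθm hθ y) c ν)]
  refine integral_congr_ae (Eventually.of_forall fun u => ?_)
  simp only [integral_mul_const]
  rw [hν.integral_exp_mul_pwz h𝔪 hg hα (Lp.memLp u)]

end Fubini

end GFFT

/-! ### Analytic continuation and existence of the transform. -/

namespace GFFT

set_option linter.unusedSectionVars false

variable {T : ℝ} [hT : Fact (0 < T)] {g : ℝ → ℝ} {M : ℝ} {α : ℕ → ℝ → ℝ}

theorem norm_exp_neg_mul_le_one {Q : ℝ} (hQ : 0 ≤ Q) {w : ℂ} (hw : 0 ≤ w.re) :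
    ‖Complex.exp (-(Q * w))‖ ≤ 1 := by
  rw [Complex.norm_exp, Real.exp_le_one_iff, Complex.neg_re, Complex.re_ofReal_mul]
  nlinarith [mul_nonneg hQ hw]

/-- `Q` may be unbounded. On `Re z > Re w / 2` the derivative is still dominated, because `Q exp(-Q
r) ≤ 1/r` for `r > 0`, used with `r = Re w / 2`. -/
theorem differentiableAt_integral_exp_neg_mul {E : Type*} [MeasurableSpace E] {μ : Measure E}
    {Q : E → ℝ} (hQm : Measurable Q) (hQ : ∀ u, 0 ≤ Q u) {ψ : E → ℂ} (hψm : Measurable ψ)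
    (hψ : Integrable ψ μ) {w : ℂ} (hw : 0 < w.re) :
    DifferentiableAt ℂ (fun w : ℂ => ∫ u, Complex.exp (-(Q u * w)) * ψ u ∂μ) w := by
  have hs : {z : ℂ | w.re / 2 < z.re} ∈ 𝓝 w :=
    (isOpen_lt continuous_const Complex.continuous_re).mem_nhds (by simpa using by linarith)
  have hm : ∀ z : ℂ, AEStronglyMeasurable (fun u => Complex.exp (-(Q u * z)) * ψ u) μ := fun z =>
    (by fun_prop : Measurable fun u => Complex.exp (-(Q u * z)) * ψ u).aestronglyMeasurable
  refine (hasDerivAt_integral_of_dominated_loc_of_deriv_le hs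
    (F := fun (z : ℂ) u => Complex.exp (-(Q u * z)) * ψ u)
    (F' := fun (z : ℂ) u => Complex.exp (-(Q u * z)) * (-(Q u : ℂ)) * ψ u)
    (bound := fun u => (w.re / 2)⁻¹ * ‖ψ u‖)
    (Eventually.of_forall hm) ?_ ?_ ?_ (hψ.norm.const_mul _) ?_).2.differentiableAt
  · refine hψ.mono (hm w) (Eventually.of_forall fun u => ?_)
    rw [norm_mul]
    exact mul_le_of_le_one_left (norm_nonneg _) (norm_exp_neg_mul_le_one (hQ u) hw.le)
  · exact (by fun_prop : Measurable fun u =>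
      Complex.exp (-(Q u * w)) * (-(Q u : ℂ)) * ψ u).aestronglyMeasurable
  · refine Eventually.of_forall fun u z hz => ?_
    rw [norm_mul]
    refine mul_le_mul_of_nonneg_right ?_ (norm_nonneg _)
    rw [norm_mul, norm_neg, Complex.norm_real, Real.norm_of_nonneg (hQ u), Complex.norm_exp,
      Complex.neg_re, Complex.re_ofReal_mul]
    have hz' : w.re / 2 < z.re := hz
    have h2 : 0 < w.re / 2 := by linarith
    have h3 : Real.exp (-(Q u * z.re)) ≤ Real.exp (-(Q u * (w.re / 2))) :=
      Real.exp_le_exp.2 (neg_le_neg (mul_le_mul_of_nonneg_left hz'.le (hQ u)))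
    refine (mul_le_mul_of_nonneg_right h3 (hQ u)).trans ?_
    rw [Real.exp_neg, inv_mul_le_iff₀ (Real.exp_pos _), mul_comm, inv_mul_eq_div, le_div_iff₀ h2]
    have := Real.add_one_le_exp (Q u * (w.re / 2))
    linarith
  · refine Eventually.of_forall fun u z _ => ?_
    have h1 : HasDerivAt (fun z : ℂ => -(Q u * z)) (-(Q u : ℂ)) z := by
      have := ((hasDerivAt_id z).const_mul (Q u : ℂ)).neg
      rwa [mul_one] at this
    exact (h1.cexp).mul_const _

theorem re_inv_two_mul_pos {lam : ℂ} (h : 0 < lam.re) : 0 < ((2 * lam)⁻¹).re := by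
  have h1 : 0 < (2 * lam).re := by simpa using h
  rw [Complex.inv_re]
  refine div_pos h1 (Complex.normSq_pos.2 fun h0 => ?_)
  rw [h0] at h1
  simp at h1

/-- The factor by which the transform with parameter `lam` changes the representing measure. -/
def heatFactor (T : ℝ) (g : ℝ → ℝ) (lam : ℂ) (u : L2 T) : ℂ :=
  Complex.exp (-(energy T g u * (2 * lam)⁻¹))

theorem measurable_heatFactor (hg : IsEssBounded T g M) (lam : ℂ) :
    Measurable (heatFactor T g lam) := by
  have := (continuous_energy hg).measurable
  unfold heatFactor
  fun_prop

theorem norm_heatFactor_le_one {lam : ℂ} (h : 0 ≤ ((2 * lam)⁻¹).re) (u : L2 T) :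
    ‖heatFactor T g lam u‖ ≤ 1 :=
  norm_exp_neg_mul_le_one (energy_nonneg _) h

theorem integrable_heatFactor_mul (hg : IsEssBounded T g M) {μ : Measure (L2 T)} {θ : L2 T → ℂ}
    (hθ : Integrable θ μ) {lam : ℂ} (h : 0 ≤ ((2 * lam)⁻¹).re) :
    Integrable (fun u => heatFactor T g lam u * θ u) μ :=
  hθ.bdd_mul (c := 1) (measurable_heatFactor hg lam).aestronglyMeasurable
    (Eventually.of_forall (norm_heatFactor_le_one h))

/-- On the boundary the exponent is imaginary, so the bound of the heat factor by one persists at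
`-iq`. -/
theorem re_minusI (q : ℝ) : ((2 * (-(Complex.I * q)))⁻¹).re = 0 := by
  rw [Complex.inv_re]
  simp

/-- The algebraic core of the inversion: the exponent is odd in `q`. -/
theorem heatFactor_minusI_mul (q : ℝ) (u : L2 T) :
    heatFactor T g (-(Complex.I * ((-q : ℝ) : ℂ))) u * heatFactor T g (-(Complex.I * q)) u = 1 := by
  rw [heatFactor, heatFactor, ← Complex.exp_add, ← Complex.exp_zero]
  congr 1
  rw [Complex.ofReal_neg, mul_neg Complex.I, neg_neg, mul_neg, inv_neg]
  ring

theorem tendsto_heatFactor {q : ℝ} (hq : q ≠ 0) (u : L2 T) :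
    Tendsto (fun lam => heatFactor T g lam u) (toMinusI q)
      (𝓝 (heatFactor T g (-(Complex.I * q)) u)) := by
  have h0 : 2 * (-(Complex.I * q)) ≠ 0 := by simp [hq, Complex.I_ne_zero]
  have : ContinuousAt (fun lam : ℂ => heatFactor T g lam u) (-(Complex.I * q)) := by
    unfold heatFactor
    refine ContinuousAt.cexp (ContinuousAt.neg (continuousAt_const.mul ?_))
    exact ContinuousAt.inv₀ (by fun_prop) h0
  exact this.tendsto.mono_left nhdsWithin_le_nhds

theorem toMinusI_neBot (q : ℝ) : (toMinusI q).NeBot := by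
  refine mem_closure_iff_nhdsWithin_neBot.1 ?_
  rw [Complex.closure_setOfPred_lt_re]
  simp

instance toMinusI_isCountablyGenerated (q : ℝ) : (toMinusI q).IsCountablyGenerated := by
  unfold toMinusI
  infer_instance

theorem eventually_re_pos (q : ℝ) : ∀ᶠ lam in toMinusI q, 0 < lam.re := self_mem_nhdsWithin

/-- Identity theorem: the functions agree on the positive reals, which accumulate at 1. -/
theorem IsAnalyticWiener.eq_of_re_pos {𝔪 : Measure (C0 T)} {h : ℝ → ℝ} {F : C0 T → ℂ}
    {J J' : ℂ → ℂ} (hJ : IsAnalyticWiener 𝔪 α h F J) (hJ' : IsAnalyticWiener 𝔪 α h F J')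
    {lam : ℂ} (hl : 0 < lam.re) : J lam = J' lam := by
  have hU : IsPreconnected {z : ℂ | 0 < z.re} := (convex_halfSpace_re_gt 0).isPreconnected
  refine hJ.analytic.eqOn_of_preconnected_of_frequently_eq hJ'.analytic hU (z₀ := 1)
    (by simp) ?_ hl
  have h1 : Tendsto (fun n : ℕ => ((1 + 1 / ((n : ℝ) + 1) : ℝ) : ℂ)) atTop (𝓝[≠] 1) := by
    refine tendsto_nhdsWithin_iff.2 ⟨?_, Eventually.of_forall fun n => ?_⟩
    · have := (tendsto_const_nhds (x := (1 : ℝ))).add (tendsto_one_div_add_atTop_nhds_zero_nat (𝕜 := ℝ))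
      rw [add_zero] at this
      exact (Complex.continuous_ofReal.tendsto' _ 1 Complex.ofReal_one).comp this
    · have : (0 : ℝ) < 1 / ((n : ℝ) + 1) := by positivity
      simp only [Set.mem_compl_iff, Set.mem_singleton_iff]
      rw [Complex.ofReal_eq_one]
      linarith
  refine h1.frequently (Frequently.of_forall fun n => ?_)
  have hpos : (0 : ℝ) < 1 + 1 / ((n : ℝ) + 1) := by positivity
  rw [hJ.eq_integral _ hpos, hJ'.eq_integral _ hpos]

section Transform

variable {μ : Measure (L2 T)} [IsFiniteMeasure μ] {θ : L2 T → ℂ} {F : C0 T → ℂ} {y : C0 T}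
  {𝔪 : Measure (C0 T)} {h : ℝ → ℝ}

theorem Represents.isAnalyticWiener (hα : IsCompleteOrthonormalBV T α) (hF : Represents α μ θ F)
    (hθm : Measurable θ) (hθ : Integrable θ μ) (h𝔪 : IsWienerMeasure 𝔪) (hh : IsEssBounded T h M)
    (hy : IsGoodPath α μ y) :
    IsAnalyticWiener 𝔪 α h (fun x => F (y + x)) fun lam =>
      ∫ u, heatFactor T h lam u * (Complex.exp (Complex.I * (pwz α u y : ℝ)) * θ u) ∂μ := by
  have := h𝔪.isProbabilityMeasure
  have hZ := aemeasurable_gaussianPath h𝔪 hα hh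
  have hν := hasVarianceDensity_map_gaussianPath h𝔪 hα hh
  have : IsProbabilityMeasure (𝔪.map (gaussianPath α h)) := Measure.isProbabilityMeasure_map hZ
  have hint := fun c => hF.integrable hα hθm hθ h𝔪 hν hh hy c
  refine ⟨fun ρ _ => ?_, fun lam hl => ?_, fun lam hl => ?_, ?_⟩
  -- Scale measurability concerns Wiener measure itself (density 1), whereas the integrability below
  -- concerns the law of `𝒵_h`.
  · exact (hF.integrable hα hθm hθ h𝔪 h𝔪.hasVarianceDensity isEssBounded_one hy
      ρ).aestronglyMeasurable.aemeasurable
  · exact (integrable_map_measure (hint _).aestronglyMeasurable hZ).1 (hint _)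
  · rw [← integral_map (f := fun z => F (y + (√lam)⁻¹ • z)) hZ (hint _).aestronglyMeasurable,
      hF.integral_eq hα hθm hθ h𝔪 hν hh hy]
    refine integral_congr_ae (Eventually.of_forall fun u => ?_)
    simp only [heatFactor]
    rw [inv_pow, Real.sq_sqrt hl.le, Complex.ofReal_exp]
    congr 2
    push_cast
    rw [mul_inv]
    ring
  · refine DifferentiableOn.analyticOnNhd (fun lam hl => ?_)
      (isOpen_lt continuous_const Complex.continuous_re)
    have hl' : 0 < lam.re := hl
    have h1 := differentiableAt_integral_exp_neg_mul (continuous_energy hh).measurable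
      (fun u => energy_nonneg _) (measurable_exp_pwz_mul hα hθm y)
      (integrable_exp_pwz_mul hα hθm hθ y) (re_inv_two_mul_pos hl')
    have h2 : DifferentiableAt ℂ (fun lam : ℂ => (2 * lam)⁻¹) lam := by
      refine DifferentiableAt.inv (by fun_prop) fun h0 => ?_
      have := re_inv_two_mul_pos hl'
      rw [h0] at this
      simp at this
    exact (h1.comp lam h2).differentiableWithinAt

/-- The continuation chosen in the definition is identified by uniqueness. The transform is again a
represented functional, so its measurability and bounds follow from the general lemmas. -/
theorem Represents.transform_eq (hα : IsCompleteOrthonormalBV T α) (hF : Represents α μ θ F)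
    (hθm : Measurable θ) (hθ : Integrable θ μ) (h𝔪 : IsWienerMeasure 𝔪) (hh : IsEssBounded T h M)
    {lam : ℂ} (hl : 0 < lam.re) :
    Represents α μ (fun u => heatFactor T h lam u * θ u) (transform 𝔪 α h F lam) := by
  intro y hy
  have hJ := hF.isAnalyticWiener hα hθm hθ h𝔪 hh hy
  have hex : AnalyticWienerExists 𝔪 α h (fun x => F (y + x)) := ⟨_, hJ⟩
  rw [transform, analyticWiener, dif_pos hex, hex.choose_spec.eq_of_re_pos hJ hl]
  exact integral_congr_ae (Eventually.of_forall fun u => by ring)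

theorem isGoodPath_zero (hα : IsCompleteOrthonormalBV T α) : IsGoodPath α μ 0 := by
  refine Eventually.of_forall fun u => ⟨0, ?_⟩
  have h0 : ∀ j, stieltjes (α j) (0 : C0 T) = 0 := fun j => by
    simpa using stieltjes_smul (hα.boundedVariation j) 0 (0 : C0 T)
  refine tendsto_const_nhds.congr fun n => ?_
  simp [pwzSum, h0]

theorem Represents.scaleMeasurable (hα : IsCompleteOrthonormalBV T α) (hF : Represents α μ θ F)
    (hθm : Measurable θ) (hθ : Integrable θ μ) (h𝔪 : IsWienerMeasure 𝔪) :
    ScaleMeasurable 𝔪 F := by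
  have := h𝔪.isProbabilityMeasure
  intro ρ _
  have := (hF.integrable hα hθm hθ h𝔪 h𝔪.hasVarianceDensity isEssBounded_one
    (isGoodPath_zero hα) ρ).aestronglyMeasurable.aemeasurable
  simpa only [zero_add] using this

theorem Represents.norm_le (hF : Represents α μ θ F) (hy : IsGoodPath α μ y) :
    ‖F y‖ ≤ ∫ u, ‖θ u‖ ∂μ := by
  rw [hF y hy]
  refine (norm_integral_le_integral_norm _).trans (le_of_eq ?_)
  refine integral_congr_ae (Eventually.of_forall fun u => ?_)
  simp only [norm_mul, norm_exp_I_mul_ofReal, one_mul]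

theorem Represents.tendsto_transform (hα : IsCompleteOrthonormalBV T α) (hF : Represents α μ θ F)
    (hθm : Measurable θ) (hθ : Integrable θ μ) (h𝔪 : IsWienerMeasure 𝔪) (hh : IsEssBounded T h M)
    {q : ℝ} (hq : q ≠ 0) {G : C0 T → ℂ}
    (hG : Represents α μ (fun u => heatFactor T h (-(Complex.I * q)) u * θ u) G)
    (hy : IsGoodPath α μ y) :
    Tendsto (fun lam => transform 𝔪 α h F lam y) (toMinusI q) (𝓝 (G y)) := by
  rw [hG y hy]
  have h1 : Tendsto (fun lam => ∫ u, Complex.exp (Complex.I * (pwz α u y : ℂ)) *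
      (heatFactor T h lam u * θ u) ∂μ) (toMinusI q)
      (𝓝 (∫ u, Complex.exp (Complex.I * (pwz α u y : ℂ)) *
        (heatFactor T h (-(Complex.I * q)) u * θ u) ∂μ)) := by
    refine tendsto_integral_filter_of_dominated_convergence (fun u => ‖θ u‖) ?_ ?_ hθ.norm ?_
    · exact Eventually.of_forall fun lam => (measurable_exp_pwz_mul hα
        ((measurable_heatFactor hh lam).mul hθm) y).aestronglyMeasurable
    · filter_upwards [eventually_re_pos q] with lam hl
      refine Eventually.of_forall fun u => ?_
      rw [norm_mul, norm_exp_I_mul_ofReal, one_mul, norm_mul]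
      exact mul_le_of_le_one_left (norm_nonneg _)
        (norm_heatFactor_le_one (re_inv_two_mul_pos hl).le u)
    · exact Eventually.of_forall fun u => ((tendsto_heatFactor hq u).mul_const _).const_mul _
  refine h1.congr' ?_
  filter_upwards [eventually_re_pos q] with lam hl
  exact (hF.transform_eq hα hθm hθ h𝔪 hh hl y hy).symm

/-- On good paths the transforms converge pointwise, and they and the limit are bounded by `∫ ‖θ‖
dμ`. Bounded convergence gives the limit in the mean. -/
theorem Represents.isGFFT (hα : IsCompleteOrthonormalBV T α) (hF : Represents α μ θ F)
    (hθm : Measurable θ) (hθ : Integrable θ μ) (h𝔪 : IsWienerMeasure 𝔪) (hh : IsEssBounded T h M)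
    {p q : ℝ} (hq : q ≠ 0) {G : C0 T → ℂ}
    (hG : Represents α μ (fun u => heatFactor T h (-(Complex.I * q)) u * θ u) G) :
    IsGFFT 𝔪 α h p q F G := by
  have := h𝔪.isProbabilityMeasure
  have hgood := h𝔪.sAE_isGoodPath hα μ
  refine ⟨fun ρ hρ => ?_, fun _ ρ hρ => ?_, fun hp ρ hρ => ⟨fun lam hl => ?_, ?_⟩⟩
  · filter_upwards [hgood ρ hρ] with y hy
    exact ⟨_, hF.isAnalyticWiener hα hθm hθ h𝔪 hh hy⟩
  · filter_upwards [hgood ρ hρ] with y hy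
    exact hF.tendsto_transform hα hθm hθ h𝔪 hh hq hG hy
  all_goals
    have hT : ∀ lam : ℂ, 0 < lam.re →
        AEMeasurable (fun y => transform 𝔪 α h F lam (ρ • y) - G (ρ • y)) 𝔪 := fun lam hl =>
      ((hF.transform_eq hα hθm hθ h𝔪 hh hl).scaleMeasurable hα
        ((measurable_heatFactor hh lam).mul hθm)
        (integrable_heatFactor_mul hh hθ (re_inv_two_mul_pos hl).le) h𝔪 ρ hρ).sub
      (hG.scaleMeasurable hα ((measurable_heatFactor hh _).mul hθm)
        (integrable_heatFactor_mul hh hθ (re_minusI q).ge) h𝔪 ρ hρ)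
  · exact hT lam hl
  · set r := p / (p - 1)
    have hr : 0 < r := div_pos (by linarith) (by linarith)
    have hle : ∀ lam : ℂ, 0 ≤ ((2 * lam)⁻¹).re →
        ∫ u, ‖heatFactor T h lam u * θ u‖ ∂μ ≤ ∫ u, ‖θ u‖ ∂μ := fun lam hl =>
      integral_mono (integrable_heatFactor_mul hh hθ hl).norm hθ.norm fun u => by
        rw [norm_mul]
        exact mul_le_of_le_one_left (norm_nonneg _) (norm_heatFactor_le_one hl u)
    have h0 : Tendsto (fun lam : ℂ =>
        ∫⁻ y, ‖transform 𝔪 α h F lam (ρ • y) - G (ρ • y)‖ₑ ^ r ∂𝔪) (toMinusI q)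
        (𝓝 (∫⁻ _ : C0 T, 0 ∂𝔪)) := by
      refine tendsto_lintegral_filter_of_dominated_convergence'
        (fun _ => ENNReal.ofReal (2 * ∫ u, ‖θ u‖ ∂μ) ^ r) ?_ ?_ ?_ ?_
      · filter_upwards [eventually_re_pos q] with lam hl
        exact (hT lam hl).enorm.pow_const r
      · filter_upwards [eventually_re_pos q] with lam hl
        filter_upwards [hgood ρ hρ] with y hy
        refine ENNReal.rpow_le_rpow ?_ hr.le
        rw [← ofReal_norm]
        refine ENNReal.ofReal_le_ofReal ((norm_sub_le _ _).trans ?_)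
        rw [two_mul]
        exact add_le_add (((hF.transform_eq hα hθm hθ h𝔪 hh hl).norm_le hy).trans
            (hle _ (re_inv_two_mul_pos hl).le))
          ((hG.norm_le hy).trans (hle _ (re_minusI q).ge))
      · rw [lintegral_const, measure_univ, mul_one]
        exact ENNReal.rpow_ne_top_of_nonneg hr.le ENNReal.ofReal_ne_top
      · filter_upwards [hgood ρ hρ] with y hy
        have h1 := ((hF.tendsto_transform hα hθm hθ h𝔪 hh hq hG hy).sub_const (G (ρ • y))).enorm
        rw [sub_self, enorm_zero] at h1
        have h2 := h1.ennrpow_const r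
        rwa [ENNReal.zero_rpow_of_pos hr] at h2
    rwa [lintegral_zero] at h0

end Transform

/-! ### Uniqueness of versions and of densities, and the inversion. -/

theorem IsGFFT.scaleEq {𝔪 : Measure (C0 T)} {h : ℝ → ℝ} {p q : ℝ} (hp : 1 ≤ p)
    {F G G' : C0 T → ℂ} (hG : IsGFFT 𝔪 α h p q F G) (hG' : IsGFFT 𝔪 α h p q F G') :
    ScaleEq 𝔪 G G' := by
  have := toMinusI_neBot q
  intro ρ hρ
  rcases hp.eq_or_lt with hp | hp
  · filter_upwards [hG.2.1 hp.symm ρ hρ, hG'.2.1 hp.symm ρ hρ] with y h1 h2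
    exact tendsto_nhds_unique h1 h2
  obtain ⟨hm, ht⟩ := hG.2.2 hp ρ hρ
  obtain ⟨hm', ht'⟩ := hG'.2.2 hp ρ hρ
  set r := p / (p - 1)
  have hr : 1 ≤ r := by
    rw [one_le_div (by linarith)]
    linarith
  set t := transform 𝔪 α h F
  -- Neither `G` nor `G'` is assumed measurable; their difference is, by subtracting the two
  -- measurable differences at the arbitrary parameter `λ = 1`.
  have hmeas : AEMeasurable (fun y => G (ρ • y) - G' (ρ • y)) 𝔪 := by
    refine ((hm' 1 (by simp)).sub (hm 1 (by simp))).congr (Eventually.of_forall fun y => ?_)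
    simp
  have hle : ∀ᶠ lam in toMinusI q, ∫⁻ y, ‖G (ρ • y) - G' (ρ • y)‖ₑ ^ r ∂𝔪 ≤
      2 ^ (r - 1) * (∫⁻ y, ‖t lam (ρ • y) - G (ρ • y)‖ₑ ^ r ∂𝔪 +
        ∫⁻ y, ‖t lam (ρ • y) - G' (ρ • y)‖ₑ ^ r ∂𝔪) := by
    filter_upwards [eventually_re_pos q] with lam hl
    rw [← lintegral_add_left' ((hm lam hl).enorm.pow_const r),
      ← lintegral_const_mul' _ _ (ENNReal.rpow_ne_top_of_nonneg (by linarith) (by simp))]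
    refine lintegral_mono fun y => ?_
    refine le_trans (ENNReal.rpow_le_rpow ?_ (by linarith))
      (ENNReal.rpow_add_le_mul_rpow_add_rpow _ _ hr)
    rw [show G (ρ • y) - G' (ρ • y) = (t lam (ρ • y) - G' (ρ • y)) - (t lam (ρ • y) - G (ρ • y)) by
      ring, add_comm]
    exact enorm_sub_le
  have hlim := ENNReal.Tendsto.const_mul (a := (2 : ENNReal) ^ (r - 1)) (ht.add ht')
    (Or.inr (ENNReal.rpow_ne_top_of_nonneg (by linarith) (by simp)))
  rw [add_zero, mul_zero] at hlim
  have hzero := le_antisymm (ge_of_tendsto hlim hle) zero_le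
  rw [lintegral_eq_zero_iff' (hmeas.enorm.pow_const r)] at hzero
  filter_upwards [hzero] with y hy
  rw [Pi.zero_apply, ENNReal.rpow_eq_zero_iff_of_pos (by linarith), enorm_eq_zero] at hy
  exact sub_eq_zero.1 hy

/-- The Wiener integral of `exp(-i⟨v,x⟩) (F - G)(x)` vanishes. By Fubini it equals the integral of
`exp(-‖u - v‖²/2) (θ - η)(u)`, since `⟨u - v, x⟩` has variance `‖u - v‖²`. -/
theorem Represents.ae_eq_of_scaleEq {μ : Measure (L2 T)} [IsFiniteMeasure μ] {θ η : L2 T → ℂ}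
    {F G : C0 T → ℂ} {𝔪 : Measure (C0 T)} (hα : IsCompleteOrthonormalBV T α)
    (hF : Represents α μ θ F) (hG : Represents α μ η G) (hθm : Measurable θ) (hθ : Integrable θ μ)
    (hηm : Measurable η) (hη : Integrable η μ) (h𝔪 : IsWienerMeasure 𝔪) (h : ScaleEq 𝔪 F G) :
    θ =ᵐ[μ] η := by
  have := h𝔪.isProbabilityMeasure
  have hHVD := h𝔪.hasVarianceDensity
  have hgood := hHVD.ae_isGoodPath h𝔪 isEssBounded_one hα μ
  suffices hs : θ - η =ᵐ[μ] 0 by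
    filter_upwards [hs] with u hu
    exact sub_eq_zero.1 hu
  have : Fact ((2 : ENNReal) ≠ ⊤) := ⟨ENNReal.ofNat_ne_top⟩
  refine ae_eq_zero_of_integral_gaussian (hθm.sub hηm) (hθ.sub hη) fun v => ?_
  set Φ : C0 T × L2 T → ℂ := fun z => Complex.exp (-(Complex.I * (pwz α v z.1 : ℝ))) *
    (Complex.exp (Complex.I * (1 * pwz α z.2 z.1 : ℝ)) * (θ - η) z.2)
  have hΦ : Integrable Φ (𝔪.prod μ) := by
    have hv : Measurable fun z : C0 T × L2 T => pwz α v z.1 :=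
      (measurable_pwz (v : ℝ → ℝ)).comp measurable_fst
    refine (integrable_exp_pwz_prod_mul hα (hθm.sub hηm) (hθ.sub hη) 1 𝔪).bdd_mul (c := 1)
      (by fun_prop : Measurable fun z : C0 T × L2 T =>
        Complex.exp (-(Complex.I * (pwz α v z.1 : ℝ)))).aestronglyMeasurable
      (Eventually.of_forall fun z => ?_)
    rw [← mul_neg, ← Complex.ofReal_neg, norm_exp_I_mul_ofReal]
  have h1 : ∫ x, ∫ u, Φ (x, u) ∂μ ∂𝔪 = 0 := by
    refine integral_eq_zero_of_ae ?_
    filter_upwards [h 1 one_pos, hgood] with x hx hgx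
    rw [one_smul, hF x hgx, hG x hgx] at hx
    simp only [Φ, Pi.zero_apply, integral_const_mul, one_mul, Pi.sub_apply]
    simp_rw [mul_sub (Complex.exp (Complex.I * _))]
    rw [integral_sub (integrable_exp_pwz_mul hα hθm hθ x) (integrable_exp_pwz_mul hα hηm hη x), hx,
      sub_self, mul_zero]
  rw [integral_integral_swap hΦ] at h1
  rw [← h1]
  refine integral_congr_ae (Eventually.of_forall fun u => ?_)
  have h2 := hHVD.integral_exp_pwz h𝔪 isEssBounded_one hα (Lp.memLp (u - v))
  rw [energy_one] at h2
  simp only [Φ]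
  simp_rw [← mul_assoc, integral_mul_const]
  rw [← h2]
  congr 1
  refine integral_congr_ae ?_
  filter_upwards [hHVD.ae_exists_hasPWZ h𝔪 isEssBounded_one hα (Lp.memLp u),
    hHVD.ae_exists_hasPWZ h𝔪 isEssBounded_one hα (Lp.memLp v)] with x hx hx'
  have h3 : HasPWZ α (u - v : L2 T) x (pwz α u x - pwz α v x) := by
    refine ((hasPWZ_pwz hx).sub (hasPWZ_pwz hx')).congr fun n => ?_
    simp only [pwzSum]
    rw [← Finset.sum_sub_distrib]
    refine Finset.sum_congr rfl fun j _ => ?_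
    rw [← sub_mul]
    congr 1
    have hj := BoundedVariationOn.memLp_two (hα.boundedVariation j)
    refine (integral_sub ((Lp.memLp u).integrable_mul hj)
      ((Lp.memLp v).integrable_mul hj)).symm.trans ?_
    refine integral_congr_ae ?_
    filter_upwards [Lp.coeFn_sub u v] with τ hτ
    simp only [hτ, Pi.sub_apply, Pi.mul_apply]
    ring
  rw [h3.pwz_eq, ← Complex.exp_add]
  congr 1
  push_cast
  ring

theorem Represents.congr {μ : Measure (L2 T)} {θ η : L2 T → ℂ} {F : C0 T → ℂ}
    (hF : Represents α μ θ F) (h : θ =ᵐ[μ] η) : Represents α μ η F := by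
  intro x hx
  rw [hF x hx]
  refine integral_congr_ae ?_
  filter_upwards [h] with u hu
  rw [hu]

theorem exists_isEssBounded {h : ℝ → ℝ} (hh : MemLp h ⊤ (volume.restrict (Set.Icc 0 T))) :
    ∃ M, IsEssBounded T h M := by
  refine ⟨(eLpNormEssSup h (volume.restrict (Set.Icc 0 T))).toReal + 1, hh.1, ?_,
    by positivity⟩
  have hfin : eLpNormEssSup h (volume.restrict (Set.Icc 0 T)) ≠ ⊤ := by
    have := hh.2.ne
    rwa [eLpNorm_exponent_top] at this
  filter_upwards [ae_le_eLpNormEssSup (f := h) (μ := volume.restrict (Set.Icc 0 T))] with τ hτ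
  have := ENNReal.toReal_mono hfin hτ
  rw [toReal_enorm, Real.norm_eq_abs] at this
  linarith

/-- For the forward direction, the functional built from the multiplied density is one version. Any
other is `≈` to it, hence has the same density. -/
theorem isGFFT_iff {𝔪 : Measure (C0 T)} (h𝔪 : IsWienerMeasure 𝔪)
    (hα : IsCompleteOrthonormalBV T α) {h : ℝ → ℝ} (hh : IsEssBounded T h M) {p q : ℝ}
    (hp : 1 ≤ p) (hq : q ≠ 0) {μ : Measure (L2 T)} [IsFiniteMeasure μ] {θ η : L2 T → ℂ}
    {F G : C0 T → ℂ} (hF : Represents α μ θ F) (hG : Represents α μ η G) (hθm : Measurable θ)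
    (hθ : Integrable θ μ) (hηm : Measurable η) (hη : Integrable η μ) :
    IsGFFT 𝔪 α h p q F G ↔ (fun u => heatFactor T h (-(Complex.I * q)) u * θ u) =ᵐ[μ] η := by
  refine ⟨fun hFG => ?_, fun hθη => hF.isGFFT hα hθm hθ h𝔪 hh hq (hG.congr hθη.symm)⟩
  have hm := (measurable_heatFactor hh (-(Complex.I * q))).mul hθm
  have hi := integrable_heatFactor_mul hh hθ (re_minusI q).ge
  obtain ⟨G₀, -, hG₀⟩ := exists_represents_mem_classS hα hm hi
  exact hG₀.ae_eq_of_scaleEq hα hG hm hi hηm hη h𝔪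
    ((hF.isGFFT hα hθm hθ h𝔪 hh hq hG₀).scaleEq hp hFG)

theorem isGFFT_comm {𝔪 : Measure (C0 T)} (h𝔪 : IsWienerMeasure 𝔪)
    (hα : IsCompleteOrthonormalBV T α) {h : ℝ → ℝ} (hh : IsEssBounded T h M) {p q : ℝ}
    (hp : 1 ≤ p) (hq : q ≠ 0) {F G : C0 T → ℂ} (hF : F ∈ (classS α : Set (C0 T → ℂ)))
    (hG : G ∈ (classS α : Set (C0 T → ℂ))) :
    IsGFFT 𝔪 α h p q F G ↔ IsGFFT 𝔪 α h p (-q) G F := by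
  obtain ⟨μ, _, θ, η, hθm, hθ, hηm, hη, hF, hG⟩ := exists_represents_pair hα hF hG
  rw [isGFFT_iff h𝔪 hα hh hp hq hF hG hθm hθ hηm hη,
    isGFFT_iff h𝔪 hα hh hp (neg_ne_zero.2 hq) hG hF hηm hη hθm hθ]
  refine ⟨fun h => ?_, fun h => ?_⟩
  · filter_upwards [h] with u hu
    rw [← hu, ← mul_assoc, heatFactor_minusI_mul, one_mul]
  · filter_upwards [h] with u hu
    rw [← hu, ← mul_assoc, mul_comm (heatFactor T _ _ u), heatFactor_minusI_mul, one_mul]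

theorem exists_isGFFT {𝔪 : Measure (C0 T)} (h𝔪 : IsWienerMeasure 𝔪)
    (hα : IsCompleteOrthonormalBV T α) {h : ℝ → ℝ} (hh : IsEssBounded T h M) {p q : ℝ}
    (hq : q ≠ 0) {F : C0 T → ℂ} (hF : F ∈ (classS α : Set (C0 T → ℂ))) :
    ∃ G ∈ (classS α : Set (C0 T → ℂ)), IsGFFT 𝔪 α h p q F G := by
  obtain ⟨μ, _, θ, -, hθm, hθ, -, -, hF, -⟩ := exists_represents_pair hα hF hF
  obtain ⟨G, hG, hG'⟩ := exists_represents_mem_classS hα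
    ((measurable_heatFactor hh (-(Complex.I * q))).mul hθm)
    (integrable_heatFactor_mul hh hθ (re_minusI q).ge)
  exact ⟨G, hG, hF.isGFFT hα hθm hθ h𝔪 hh hq hG'⟩

end GFFT

end

theorem corollary3p3 (T : ℝ) [Fact (0 < T)]
    (𝔪 : Measure (GFFT.C0 T)) (h𝔪 : GFFT.IsWienerMeasure 𝔪)
    (α : ℕ → ℝ → ℝ) (hα : GFFT.IsCompleteOrthonormalBV T α)
    (h : ℝ → ℝ) (hh : MemLp h ⊤ (volume.restrict (Set.Icc 0 T)))
    (hh0 : ¬ h =ᵐ[volume.restrict (Set.Icc 0 T)] 0)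
    (p : ℝ) (hp1 : 1 ≤ p) (hp2 : p ≤ 2) (q : ℝ) (hq : q ≠ 0) :
    -- for `F` in `𝒮(L₂[0,T])` the transform exists in `𝒮(L₂[0,T])`, so does the transform of the
    -- transform, and the latter is `≈ F`
    (∀ F ∈ (GFFT.classS α : Set (GFFT.C0 T → ℂ)),
      (∃ G ∈ (GFFT.classS α : Set (GFFT.C0 T → ℂ)), GFFT.IsGFFT 𝔪 α h p q F G) ∧
      ∀ G ∈ (GFFT.classS α : Set (GFFT.C0 T → ℂ)), GFFT.IsGFFT 𝔪 α h p q F G →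
        (∃ K ∈ (GFFT.classS α : Set (GFFT.C0 T → ℂ)), GFFT.IsGFFT 𝔪 α h p (-q) G K) ∧
        ∀ K : GFFT.C0 T → ℂ, GFFT.IsGFFT 𝔪 α h p (-q) G K → GFFT.ScaleEq 𝔪 K F) ∧
    -- the transform with parameter `-q` is the inverse of the transform with parameter `q`
    (∀ F ∈ (GFFT.classS α : Set (GFFT.C0 T → ℂ)), ∀ G ∈ (GFFT.classS α : Set (GFFT.C0 T → ℂ)),
      GFFT.IsGFFT 𝔪 α h p q F G ↔ GFFT.IsGFFT 𝔪 α h p (-q) G F) := by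
  obtain ⟨M, hM⟩ := GFFT.exists_isEssBounded hh
  refine ⟨fun F hF => ⟨GFFT.exists_isGFFT h𝔪 hα hM hq hF, fun G hG hFG => ?_⟩,
    fun F hF G hG => GFFT.isGFFT_comm h𝔪 hα hM hp1 hq hF hG⟩
  -- `F` itself is a version of the inverse transform of `G`; uniqueness of versions then handles an
  -- arbitrary `K`.
  have hGF := (GFFT.isGFFT_comm h𝔪 hα hM hp1 hq hF hG).1 hFG
  exact ⟨⟨F, hF, hGF⟩, fun K hK => hK.scaleEq hp1 hGF⟩
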